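/- **Proposition 2.6 (Tilt-excess inequality).** Let $m,n\ge 1$. Write points of $\mathbb R^{m+n}=\mathbb R^m\times\mathbb R^n$ as $(x,y)$, let $B_r\subset\mathbb R^m$ be the open ball of radius $r$ centred at $0$, and let $\mathbf C_r=B_r\times\mathbb R^n$. There are constants $C>0$ and $\delta_0>0$, depending only on $m$ and $n$, with the following property. Assume that (i) $M$ is a smooth $m$-dimensional embedded submanifold contained in $\mathbf C_2$ which is $\delta$-flat in $\mathbf C_2$ for some $\delta\le\delta_0$, i.e. $M$ is the graph $\{(x,g(x)):x\in B_2\}$ of a map $g\in C^2(B_2,\mathbb R^n)$ with $\tfrac12|g(x)|+|Dg(x)|+2|D^2g(x)|\le\delta$ for all $x\in B_2$; (ii) $V$ is an $m$-dimensional stationary integer rectifiable varifold in $\mathbf C_1$ with $\operatorname{supp}(V)\subset\{(x,y):|x|<1,\ |y|<1\}$. That is, the weight $\|V\|=\Theta\,\mathcal H^m\llcorner A$ is a Radon measure on $\mathbf C_1$, where $A\subset\mathbf C_1$ is a countably $m$-rectifiable Borel set and $\Theta$ is Borel with positive integer values; $T_zV$ denotes the approximate tangent plane, defined for $\|V\|$-a.e.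 $z$; and $\int \operatorname{div}_{T_zV}X\,d\|V\|(z)=0$ for every $X\in C_c^\infty(\mathbf C_1,\mathbb R^{m+n})$. Let $d_M$ be the distance to $M$, $\mathrm{II}$ the second fundamental form of $M$, and $H_M$ its mean curvature vector (the trace of $\mathrm{II}$). For $m$-planes $S,T$ let $|S-T|$ be the Hilbert–Schmidt norm of the difference of the orthogonal projections onto $S$ and $T$; $|\mathrm{II}|$ is also the Hilbert–Schmidt norm. Let $D_Vf(z)$ denote the gradient at $z$ of $f|_{z+T_zV}$, and let $\Delta_Vf(z)$ be the trace of $D^2f(z)$ on $T_zV$. Then every point $z$ of $\{|x|<1,|y|<1\}$ has a unique closest point $p(z)\in M$, and: 1. for $\|V\|$-a.e. $z$, $d_M$ restricted to $z+T_zV$ is differentiable at $z$ and $$|T_zV-T_{p(z)}M|^2\ \ge\ |D_Vd_M|^2(z);$$ 2. for $\|V\|$-a.e. $z$, $d_M^2$ is $C^\infty$ near $z$ and $$\Delta_V\tfrac12d_M^2(z)\ \ge\ \tfrac14|T_zV-T_{p(z)}M|^2-|H_M(p(z))|\,d_M(z)-2|\mathrm{II}(p(z))|\,d_M(z)^2;$$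 3. as an inequality in $[0,\infty]$, $$\int_{\mathbf C_{1/2}}|T_zV-T_{p(z)}M|^2\,d\|V\|(z)\ \le\ C\int_{\mathbf C_1}\big(d_M^2+d_M\,|H_M\circ p|\big)\,d\|V\|.$$ -/

import Mathlib

open MeasureTheory Filter Topology Set
open scoped ENNReal ContDiff

noncomputable section

/-! ### Planes in a Euclidean space -/

section Planes

variable {E : Type*} [NormedAddCommGroup E] [InnerProductSpace ℝ E] [FiniteDimensional ℝ E]

/-- `|S - T|²`: the squared Hilbert–Schmidt norm of the difference of the orthogonal projections
onto the linear subspaces `S` and `T`. -/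
def planeDistSq (S T : Submodule ℝ E) : ℝ :=
  ∑ i, ‖S.starProjection (stdOrthonormalBasis ℝ E i)
    - T.starProjection (stdOrthonormalBasis ℝ E i)‖ ^ 2

/-- `div_T X (z) = tr (P_T ∘ DX(z))`, the divergence of the vector field `X` along the
subspace `T`. -/
def divAlong (T : Submodule ℝ E) (X : E → E) (z : E) : ℝ :=
  LinearMap.trace ℝ E ((T.starProjection ∘L fderiv ℝ X z : E →L[ℝ] E) : E →ₗ[ℝ] E)

/-- `Δ_T f (z) = tr (P_T ∘ D²f(z))`, the Laplacian of `f` along the subspace `T`. -/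
def laplacianAlong (T : Submodule ℝ E) (f : E → ℝ) (z : E) : ℝ :=
  divAlong T (gradient f) z

/-- `f` is differentiable at `z` along the subspace `T`: the restriction of `f` to the affine plane
`z + T` is differentiable at `z`. -/
def DifferentiableAlong (T : Submodule ℝ E) (f : E → ℝ) (z : E) : Prop :=
  DifferentiableAt ℝ (fun v : T => f (z + v)) 0

/-- The gradient at `z` of the restriction of `f` to the affine plane `z + T`. -/
def gradientAlong (T : Submodule ℝ E) (f : E → ℝ) (z : E) : T :=
  gradient (fun v : T => f (z + v)) 0

end Planes

/-! ### Geometry of a submanifold `M` of a Euclidean space -/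

section Submanifold

variable {E : Type*} [NormedAddCommGroup E] [InnerProductSpace ℝ E] [FiniteDimensional ℝ E]

/-- The tangent space `T_q M`. -/
def tangentPlane (M : Set E) (q : E) : Submodule ℝ E :=
  Submodule.span ℝ (tangentConeAt ℝ M q)

/-- The second fundamental form `II(u, v) = (D_u v)^⊥` at `q ∈ M`, for `u, v ∈ T_q M`; the vector
`v` is extended to the tangent vector field `w ↦ P_{T_w M} v` on `M`, which is differentiated along
`M` in the tangent direction `u`. (The value of a derivative within `M` on vectors of `T_q M` does
not depend on the choice of the derivative.) -/
def secondFundamentalForm (M : Set E) (q u v : E) : E :=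
  (tangentPlane M q)ᗮ.starProjection
    (fderivWithin ℝ (fun w => (tangentPlane M w).starProjection v) M q u)

/-- The mean curvature vector `H_M(q)`, the trace of the second fundamental form. -/
def meanCurvature (M : Set E) (q : E) : E :=
  ∑ i, secondFundamentalForm M q
    (stdOrthonormalBasis ℝ (tangentPlane M q) i) (stdOrthonormalBasis ℝ (tangentPlane M q) i)

/-- The Hilbert–Schmidt norm `|II|` of the second fundamental form at `q`. -/
def secondFundamentalFormNorm (M : Set E) (q : E) : ℝ :=
  √(∑ i, ∑ j, ‖secondFundamentalForm M q
    (stdOrthonormalBasis ℝ (tangentPlane M q) i)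
    (stdOrthonormalBasis ℝ (tangentPlane M q) j)‖ ^ 2)

/-- `q` is a closest point of `M` to `z`. -/
def IsClosestPoint (M : Set E) (z q : E) : Prop :=
  q ∈ M ∧ dist z q = Metric.infDist z M

open Classical in
/-- The closest-point projection `p` onto `M` (with value `0` where no closest point exists). -/
def closestPoint (M : Set E) (z : E) : E :=
  if h : ∃ q, IsClosestPoint M z q then h.choose else 0

end Submanifold

/-! ### Integer rectifiable varifolds -/

section Varifold

variable {E : Type*} [NormedAddCommGroup E] [InnerProductSpace ℝ E] [FiniteDimensional ℝ E]
  [MeasurableSpace E] [BorelSpace E]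

/-- The `m`-dimensional Hausdorff measure with the Euclidean normalization: the factor is the
Lebesgue measure of a ball of diameter one in `ℝ^m`. -/
def hausdorff (E : Type*) [NormedAddCommGroup E] [InnerProductSpace ℝ E]
    [MeasurableSpace E] [BorelSpace E] (m : ℕ) : Measure E :=
  volume (Metric.ball (0 : EuclideanSpace ℝ (Fin m)) (1 / 2)) • μH[(m : ℝ)]

/-- `A` is countably `m`-rectifiable: up to an `H^m`-null set it is covered by countably many
Lipschitz images of `ℝ^m`. -/
def IsCountablyRectifiable (m : ℕ) (A : Set E) : Prop :=
  ∃ f : ℕ → EuclideanSpace ℝ (Fin m) → E,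
    (∀ k, ∃ K, LipschitzWith K (f k)) ∧ hausdorff E m (A \ ⋃ k, range (f k)) = 0

/-- The measure `Θ H^m ⌞ A`. -/
def weightedHausdorff (m : ℕ) (A : Set E) (Θ : E → ℕ) : Measure E :=
  ((hausdorff E m).restrict A).withDensity (fun z => (Θ z : ℝ≥0∞))

/-- `T` is the approximate tangent plane at `z` of the measure `μ`, with multiplicity `θ`: the
rescalings `r^{-m} (w ↦ (w - z) / r)_# μ` converge to `θ H^m ⌞ T` as `r ↓ 0`, tested with continuous
functions of compact support. -/
def IsApproxTangent (m : ℕ) (μ : Measure E) (θ : ℝ) (z : E) (T : Submodule ℝ E) : Prop :=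
  ∀ φ : E → ℝ, Continuous φ → HasCompactSupport φ →
    Tendsto (fun r : ℝ => (r ^ m)⁻¹ * ∫ w, φ (r⁻¹ • (w - z)) ∂μ) (𝓝[>] 0)
      (𝓝 (θ * ∫ w in (T : Set E), φ w ∂(hausdorff E m)))

/-- An `m`-dimensional integer rectifiable varifold in the open set `U`: the Radon measure
`Θ H^m ⌞ A` on `U`, with `A ⊆ U` rectifiable and `Θ` Borel with positive integer values, together
with the (measurable) field of its approximate tangent planes. Equivalently, it is the Radon measure
on `U × G_m` whose marginal on `U` is `Θ H^m ⌞ A` and whose disintegration is the Dirac mass at the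
approximate tangent plane. -/
structure IntegralVarifold (m : ℕ) (U : Set E) where
  /-- the rectifiable set `A` -/
  carrier : Set E
  /-- the multiplicity `Θ` -/
  density : E → ℕ
  /-- the tangent planes `T_z V` -/
  tangent : E → Submodule ℝ E
  measurableSet_carrier : MeasurableSet carrier
  carrier_subset : carrier ⊆ U
  rectifiable : IsCountablyRectifiable m carrier
  measurable_density : Measurable density
  density_pos : ∀ z ∈ carrier, 0 < density z
  finite_on_compacts : ∀ K ⊆ U, IsCompact K → weightedHausdorff m carrier density K < ⊤
  finrank_tangent : ∀ z, Module.finrank ℝ (tangent z) = m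
  measurable_tangent : ∀ v : E, Measurable fun z => (tangent z).starProjection v
  isApproxTangent : ∀ᵐ z ∂weightedHausdorff m carrier density,
    IsApproxTangent m (weightedHausdorff m carrier density) (density z) z (tangent z)

namespace IntegralVarifold

variable {m : ℕ} {U : Set E}

/-- The weight measure `‖V‖ = Θ H^m ⌞ A`. -/
def weight (V : IntegralVarifold m U) : Measure E :=
  weightedHausdorff m V.carrier V.density

/-- The support of `V` in `U`. -/
def supp (V : IntegralVarifold m U) : Set E := U ∩ V.weight.support

/-- `V` is stationary in `U`: its first variation `δV(X) = ∫ div_{T_z V} X d‖V‖` vanishes for every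
smooth vector field `X` with compact support in `U`. -/
def IsStationary (V : IntegralVarifold m U) : Prop :=
  ∀ X : E → E, ContDiff ℝ ∞ X → HasCompactSupport X → tsupport X ⊆ U →
    ∫ z, divAlong (V.tangent z) X z ∂V.weight = 0

end IntegralVarifold

end Varifold

/-! ### The space `ℝ^m × ℝ^n`, cylinders and flat submanifolds -/

/-- `ℝ^{m+n} = ℝ^m × ℝ^n` with the Euclidean norm. -/
abbrev Ambient (m n : ℕ) : Type :=
  WithLp 2 (EuclideanSpace ℝ (Fin m) × EuclideanSpace ℝ (Fin n))

/-- The open cylinder `C_r = B_r × ℝ^n`. -/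
def openCylinder (m n : ℕ) (r : ℝ) : Set (Ambient m n) := {z | ‖z.fst‖ < r}

/-- `B_1(0, π₀) + B_1(0, π₀^⊥) = {(x, y) : |x| < 1, |y| < 1}`. -/
def unitSlab (m n : ℕ) : Set (Ambient m n) := {z | ‖z.fst‖ < 1 ∧ ‖z.snd‖ < 1}

/-- `M` is an `m`-dimensional smooth (embedded) submanifold of `ℝ^m × ℝ^n`: near each of its points
a smooth diffeomorphism between open sets straightens it to `ℝ^m × {0}`. -/
def IsSmoothSubmanifold {m n : ℕ} (M : Set (Ambient m n)) : Prop :=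
  ∀ q ∈ M, ∃ Ψ : OpenPartialHomeomorph (Ambient m n) (Ambient m n),
    q ∈ Ψ.source ∧ ContDiffOn ℝ ∞ Ψ Ψ.source ∧ ContDiffOn ℝ ∞ Ψ.symm Ψ.target ∧
      ∀ w ∈ Ψ.source, w ∈ M ↔ (Ψ w).snd = 0

/-- `M` is `δ`-flat in `C_r`: `M ∩ C_r` is the graph of a map `g ∈ C²(B_r, ℝ^n)` with
`r⁻¹ |g| + |Dg| + r |D²g| ≤ δ` on `B_r`. -/
def IsFlatIn {m n : ℕ} (δ : ℝ) (M : Set (Ambient m n)) (r : ℝ) : Prop :=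
  ∃ g : EuclideanSpace ℝ (Fin m) → EuclideanSpace ℝ (Fin n),
    ContDiffOn ℝ 2 g (Metric.ball 0 r) ∧
    M ∩ openCylinder m n r = {z | ‖z.fst‖ < r ∧ z.snd = g z.fst} ∧
    ∀ x ∈ Metric.ball (0 : EuclideanSpace ℝ (Fin m)) r,
      r⁻¹ * ‖g x‖ + ‖fderiv ℝ g x‖ + r * ‖fderiv ℝ (fderiv ℝ g) x‖ ≤ δ

end

set_option linter.unusedSectionVars false

/-! Write ν = z - p(z), d = |ν|, S = T_{p(z)}M and T = T_zV, and let F(x) = (x, g(x)) parametrize M.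

Closest points. `normalMap` sends a base point and the vertical component of a normal vector to the
endpoint of that vector. For small δ it differs from the identity by a map of Lipschitz constant 3δ
< 1, so it is injective and locally invertible. Every closest point yields a preimage of z; hence p
is unique, and smooth (`contDiffAt_closestPoint`).

Laplacian. The gradient of d²/2 is ν, so Δ_V(d²/2) = tr(P_T(1 - Dp)). Differentiating ν ⊥ T_{p}M
gives Dp = P_S + B Dp, where B is the shape operator of M in direction ν; therefore Dp = P_S + B +
B² Dp. The first term contributes tr(P_T(1 - P_S)) = |T - S|²/2. Replacing tr(P_T B) by tr B = ⟨ν,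
H_M⟩ costs at most |B| |T - S|²/2, which is at most half of this gain because |B| ≤ |II| d ≤ 1/2.
The last term is at most 2|B|². This linear algebra is `clmTrace_starProjection_mul_one_sub_ge`,
applied in `laplacianAlong_infDist_sq_ge`.

Gradient. Off M, the gradient of d is ν/d, which is normal to S, so its projection to T has length
at most |T - S|. On M, d need not be differentiable in the ambient space; but T_zV = T_zM at almost
every such z (`IntegralVarifold.ae_tangent_eq`, a density-point argument), and d vanishes to first
order along T_zM.

Integral estimate. Test stationarity with ζ(x)² ν for a cutoff ζ in the horizontal variable. Its
divergence is ζ² Δ_V(d²/2) + 2ζ Dζ(P_T ν), and |P_T ν| ≤ |T - S| d, so the cross term is absorbed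
into ζ²|T - S|² at the price of a multiple of d² (`sq_mul_planeDistSq_le`). -/

noncomputable section

/-! ### Traces of endomorphisms and distances between planes -/

section Trace

variable {E : Type*} [NormedAddCommGroup E] [InnerProductSpace ℝ E]

/-- The trace of a continuous endomorphism. -/
def clmTrace (A : E →L[ℝ] E) : ℝ := LinearMap.trace ℝ E (A : E →ₗ[ℝ] E)

theorem clmTrace_eq_sum {ι : Type*} [Fintype ι] (b : OrthonormalBasis ι ℝ E) (A : E →L[ℝ] E) :
    clmTrace A = ∑ i, inner ℝ (b i) (A (b i)) :=
  LinearMap.trace_eq_sum_inner _ b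

theorem clmTrace_add (A B : E →L[ℝ] E) : clmTrace (A + B) = clmTrace A + clmTrace B := by
  simp [clmTrace]

theorem clmTrace_sub (A B : E →L[ℝ] E) : clmTrace (A - B) = clmTrace A - clmTrace B := by
  simp [clmTrace]

theorem clmTrace_smul (c : ℝ) (A : E →L[ℝ] E) : clmTrace (c • A) = c * clmTrace A := by
  simp [clmTrace]

theorem clmTrace_mul_comm (A B : E →L[ℝ] E) : clmTrace (A * B) = clmTrace (B * A) :=
  LinearMap.trace_mul_comm ℝ (A : E →ₗ[ℝ] E) (B : E →ₗ[ℝ] E)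

variable [FiniteDimensional ℝ E]

theorem clmTrace_smulRight (ℓ : E →L[ℝ] ℝ) (v : E) : clmTrace (ℓ.smulRight v) = ℓ v :=
  LinearMap.trace_smulRight (ℓ : E →ₗ[ℝ] ℝ) v

theorem clmTrace_starProjection (S : Submodule ℝ E) :
    clmTrace S.starProjection = Module.finrank ℝ S := by
  refine LinearMap.IsProj.trace (p := S) ⟨fun x => ?_, fun x hx => ?_⟩
  · exact Submodule.starProjection_apply_mem S x
  · exact Submodule.starProjection_eq_self_iff.mpr hx

theorem starProjection_mul_self (S : Submodule ℝ E) :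
    S.starProjection * S.starProjection = S.starProjection := by
  ext v
  exact Submodule.starProjection_eq_self_iff.mpr (Submodule.starProjection_apply_mem S v)

theorem planeDistSq_nonneg (S T : Submodule ℝ E) : 0 ≤ planeDistSq S T :=
  Finset.sum_nonneg fun _ _ => sq_nonneg _

/-- Expands |P_S - P_T|² using that projections are symmetric and idempotent. For planes of equal
dimension the right side is 2 tr(P_T(1 - P_S)), the form in which the tilt enters the Laplacian. -/
theorem planeDistSq_eq_trace (S T : Submodule ℝ E) :
    planeDistSq S T = Module.finrank ℝ S + Module.finrank ℝ T
      - 2 * clmTrace (S.starProjection * T.starProjection) := by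
  rw [← clmTrace_starProjection S, ← clmTrace_starProjection T,
    clmTrace_eq_sum (stdOrthonormalBasis ℝ E), clmTrace_eq_sum (stdOrthonormalBasis ℝ E),
    clmTrace_eq_sum (stdOrthonormalBasis ℝ E), planeDistSq, Finset.mul_sum,
    ← Finset.sum_add_distrib, ← Finset.sum_sub_distrib]
  refine Finset.sum_congr rfl fun i _ => ?_
  set e := stdOrthonormalBasis ℝ E i
  have h1 : ∀ R : Submodule ℝ E, inner ℝ e (R.starProjection e) = ‖R.starProjection e‖ ^ 2 := by
    intro R
    rw [← real_inner_self_eq_norm_sq, Submodule.inner_starProjection_left_eq_right,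
      Submodule.starProjection_eq_self_iff.mpr (Submodule.starProjection_apply_mem R e)]
  rw [norm_sub_sq_real, h1, h1]
  rw [mul_apply_eq_comp, ← Submodule.inner_starProjection_left_eq_right S e]
  ring

theorem norm_sq_le_sum_mul (A : E →L[ℝ] E) (v : E) :
    ‖A v‖ ^ 2 ≤ (∑ i, ‖A (stdOrthonormalBasis ℝ E i)‖ ^ 2) * ‖v‖ ^ 2 := by
  set b := stdOrthonormalBasis ℝ E
  have h1 : A v = ∑ i, inner ℝ (b i) v • A (b i) := by
    conv_lhs => rw [← b.sum_repr' v]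
    simp
  have h2 : ‖A v‖ ≤ ∑ i, ‖A (b i)‖ * ‖inner ℝ (b i) v‖ := by
    rw [h1]
    refine (norm_sum_le _ _).trans (le_of_eq (Finset.sum_congr rfl fun i _ => ?_))
    rw [norm_smul, mul_comm]
  calc ‖A v‖ ^ 2 ≤ (∑ i, ‖A (b i)‖ * ‖inner ℝ (b i) v‖) ^ 2 := by gcongr
    _ ≤ (∑ i, ‖A (b i)‖ ^ 2) * ∑ i, ‖inner ℝ (b i) v‖ ^ 2 := Finset.sum_mul_sq_le_sq_mul_sq _ _ _
    _ = _ := by rw [b.sum_sq_norm_inner_right]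

theorem norm_starProjection_sub_sq_le (S T : Submodule ℝ E) (v : E) :
    ‖S.starProjection v - T.starProjection v‖ ^ 2 ≤ planeDistSq S T * ‖v‖ ^ 2 :=
  norm_sq_le_sum_mul (S.starProjection - T.starProjection) v

/-- Since P_S v = 0, P_T v equals (P_T - P_S) v. Applied to v = z - p(z), this serves both the
gradient bound and the cross term of the divergence. -/
theorem norm_starProjection_sq_le_planeDistSq (S T : Submodule ℝ E) (v : E) (hv : v ∈ Sᗮ) :
    ‖T.starProjection v‖ ^ 2 ≤ planeDistSq T S * ‖v‖ ^ 2 := by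
  have h := norm_starProjection_sub_sq_le T S v
  rwa [(Submodule.starProjection_apply_eq_zero_iff S).mpr hv, sub_zero] at h

/-! ### Symmetric operators with range in a subspace -/

section Symmetric

variable {S : Submodule ℝ E} {B : E →L[ℝ] E}

theorem starProjection_mul_of_forall_mem (hS : ∀ h, B h ∈ S) : S.starProjection * B = B := by
  ext h
  exact Submodule.starProjection_eq_self_iff.mpr (hS h)

theorem mul_starProjection_of_symmetric (hB : ∀ h k, inner ℝ (B h) k = inner ℝ h (B k))
    (hS : ∀ h, B h ∈ S) : B * S.starProjection = B := by
  ext h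
  refine ext_inner_right ℝ fun k => ?_
  rw [mul_apply_eq_comp, hB, Submodule.inner_starProjection_left_eq_right,
    Submodule.starProjection_eq_self_iff.mpr (hS k), ← hB]

theorem clmTrace_eq_sum_subspace (hB : ∀ h k, inner ℝ (B h) k = inner ℝ h (B k))
    (hS : ∀ h, B h ∈ S) {ι : Type*} [Fintype ι] (s : OrthonormalBasis ι ℝ S) :
    clmTrace B = ∑ i, inner ℝ (B (s i)) (s i : E) := by
  rw [clmTrace_eq_sum (stdOrthonormalBasis ℝ E)]
  set b := stdOrthonormalBasis ℝ E
  have h1 : ∀ k, inner ℝ (b k) (B (b k)) = ∑ i, inner ℝ (b k) (s i : E) * inner ℝ (B (s i)) (b k) := by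
    intro k
    have h2 : B (b k) = ∑ i, inner ℝ (B (s i)) (b k) • (s i : E) := by
      have h3 := congrArg (Subtype.val) (s.sum_repr' ⟨B (b k), hS (b k)⟩)
      simp only [Submodule.coe_inner, Submodule.coe_sum, Submodule.coe_smul] at h3
      rw [← h3]
      exact Finset.sum_congr rfl fun i _ => by rw [hB]
    conv_lhs => rw [h2]
    rw [inner_sum]
    exact Finset.sum_congr rfl fun i _ => by rw [inner_smul_right, mul_comm]
  simp_rw [h1]
  rw [Finset.sum_comm]
  refine Finset.sum_congr rfl fun i _ => ?_
  rw [← b.sum_inner_mul_inner (B (s i)) (s i)]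
  exact Finset.sum_congr rfl fun k _ => mul_comm _ _

theorem sum_norm_sq_eq_sum_subspace (hB : ∀ h k, inner ℝ (B h) k = inner ℝ h (B k))
    (hS : ∀ h, B h ∈ S) {ι : Type*} [Fintype ι] (s : OrthonormalBasis ι ℝ S) :
    ∑ k, ‖B (stdOrthonormalBasis ℝ E k)‖ ^ 2 = ∑ i, ∑ j, inner ℝ (B (s i)) (s j : E) ^ 2 := by
  set b := stdOrthonormalBasis ℝ E
  have h1 : ∀ h, ‖B h‖ ^ 2 = ∑ i, inner ℝ (B h) (s i : E) ^ 2 := by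
    intro h
    have := s.sum_sq_norm_inner_left ⟨B h, hS h⟩
    simp only [Submodule.coe_inner, Real.norm_eq_abs, sq_abs] at this
    rw [this]
    rfl
  have h2 : ∀ i, ∑ k, inner ℝ (B (b k)) (s i : E) ^ 2 = ‖B (s i)‖ ^ 2 := by
    intro i
    rw [← b.sum_sq_norm_inner_right]
    exact Finset.sum_congr rfl fun k _ => by rw [hB, Real.norm_eq_abs, sq_abs]
  simp_rw [h1 (b _)]
  rw [Finset.sum_comm]
  exact Finset.sum_congr rfl fun i _ => by rw [h2, h1]

end Symmetric

/-- Lower bound for the trace on `T` of `1 - L`, where `L = (1 - B)⁻¹ P_S` for a small symmetric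
endomorphism `B` of `S`. -/
theorem clmTrace_starProjection_mul_one_sub_ge {S T : Submodule ℝ E} {B L : E →L[ℝ] E} {κ : ℝ}
    (hST : Module.finrank ℝ S = Module.finrank ℝ T)
    (hB : ∀ h k, inner ℝ (B h) k = inner ℝ h (B k)) (hS : ∀ h, B h ∈ S)
    (hL : L = S.starProjection + B * L) (hκ0 : 0 ≤ κ) (hκ : κ ≤ 1 / 2)
    (hBκ : ∑ k, ‖B (stdOrthonormalBasis ℝ E k)‖ ^ 2 ≤ κ ^ 2) :
    planeDistSq T S / 4 - clmTrace B - 2 * κ ^ 2 ≤ clmTrace (T.starProjection * (1 - L)) := by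
  set P := S.starProjection
  set Q := T.starProjection
  set b := stdOrthonormalBasis ℝ E
  have hnB : ∀ v, ‖B v‖ ≤ κ * ‖v‖ := by
    intro v
    refine abs_le_of_sq_le_sq' ?_ (by positivity) |>.2
    rw [mul_pow]
    exact (norm_sq_le_sum_mul B v).trans (mul_le_mul_of_nonneg_right hBκ (sq_nonneg _))
  have hnL : ∀ v, ‖L v‖ ≤ 2 * ‖v‖ := by
    intro v
    have h1 : L v = P v + B (L v) := by
      conv_lhs => rw [hL]
      rfl
    have h2 : ‖L v‖ ≤ ‖P v‖ + ‖B (L v)‖ := by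
      conv_lhs => rw [h1]
      exact norm_add_le _ _
    have h3 : ‖P v‖ ≤ ‖v‖ := Submodule.norm_starProjection_apply_le S v
    have h4 := hnB (L v)
    have h5 : κ * ‖L v‖ ≤ 1 / 2 * ‖L v‖ := by gcongr
    linarith
  have hBP : B * P = B := mul_starProjection_of_symmetric hB hS
  have hPB : P * B = B := starProjection_mul_of_forall_mem hS
  -- The relation for L is inserted into itself; B P = B because B is symmetric with range in S.
  have hLexp : L = P + B + B * B * L := by
    conv_lhs => rw [hL, hL, mul_add, hBP, ← mul_assoc]
    rw [add_assoc]
  have hsplit : clmTrace (Q * (1 - L)) =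
      Module.finrank ℝ T - clmTrace (Q * P) - clmTrace (Q * B) - clmTrace (Q * (B * B * L)) := by
    rw [mul_sub, clmTrace_sub, mul_one, clmTrace_starProjection]
    conv_lhs => rw [hLexp]
    rw [mul_add, mul_add, clmTrace_add, clmTrace_add]
    ring
  -- Cycling the trace places one B on each side, so the bound is by the Hilbert–Schmidt norm of B,
  -- without a dimensional factor; the 2 is the bound `hnL` on L.
  have hquad : clmTrace (Q * (B * B * L)) ≤ 2 * κ ^ 2 := by
    have h1 : clmTrace (Q * (B * B * L)) = clmTrace (B * (L * Q * B)) := by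
      rw [mul_assoc B B L, ← mul_assoc Q B, clmTrace_mul_comm (Q * B), clmTrace_mul_comm B]
      simp only [mul_assoc]
      rw [clmTrace_mul_comm B]
      simp only [mul_assoc]
    rw [h1, clmTrace_eq_sum b]
    calc ∑ i, inner ℝ (b i) ((B * (L * Q * B)) (b i))
        ≤ ∑ i, 2 * ‖B (b i)‖ ^ 2 := by
          refine Finset.sum_le_sum fun i _ => ?_
          change inner ℝ (b i) (B (L (Q (B (b i))))) ≤ _
          rw [← hB]
          refine (real_inner_le_norm _ _).trans ?_
          have h3 : ‖Q (B (b i))‖ ≤ ‖B (b i)‖ := Submodule.norm_starProjection_apply_le T _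
          have h4 := hnL (Q (B (b i)))
          nlinarith [norm_nonneg (B (b i))]
      _ ≤ 2 * κ ^ 2 := by rw [← Finset.mul_sum]; linarith
  -- With R = 1 - Q the projection onto Tᗮ, the difference tr B - tr(QB) is tr(RBR). As B = PBP, its
  -- quadratic form is at least -κ times that of P, and tr(RPR) is half the squared plane distance.
  have hlin : clmTrace (Q * B) ≤ clmTrace B + κ * (Module.finrank ℝ T - clmTrace (Q * P)) := by
    set R : E →L[ℝ] E := Tᗮ.starProjection with hR
    have hRQ : R = 1 - Q := by
      ext v
      simp [hR, Q]
    have hRR : R * R = R := starProjection_mul_self Tᗮ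
    have hRsymm : ∀ u v, inner ℝ u (R v) = inner ℝ (R u) v := fun u v =>
      (Submodule.inner_starProjection_left_eq_right Tᗮ u v).symm
    have hPsymm : ∀ u v, inner ℝ u (P v) = inner ℝ (P u) v := fun u v =>
      (Submodule.inner_starProjection_left_eq_right S u v).symm
    have h1 : clmTrace B - clmTrace (Q * B) = clmTrace (R * (B * R)) := by
      rw [clmTrace_mul_comm R, mul_assoc, hRR, clmTrace_mul_comm _ R, hRQ, sub_mul, one_mul,
        clmTrace_sub]
    have h2 : Module.finrank ℝ T - clmTrace (Q * P) = clmTrace (R * (P * R)) := by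
      rw [clmTrace_mul_comm R, mul_assoc, hRR, clmTrace_mul_comm _ R, hRQ, sub_mul, one_mul,
        clmTrace_sub, clmTrace_starProjection, hST]
    have h3 : -(κ * clmTrace (R * (P * R))) ≤ clmTrace (R * (B * R)) := by
      rw [clmTrace_eq_sum b, clmTrace_eq_sum b, Finset.mul_sum, ← Finset.sum_neg_distrib]
      refine Finset.sum_le_sum fun i _ => ?_
      change -(κ * inner ℝ (b i) (R (P (R (b i))))) ≤ inner ℝ (b i) (R (B (R (b i))))
      rw [hRsymm, hRsymm]
      set v := R (b i)
      have hPv : inner ℝ v (P v) = ‖P v‖ ^ 2 := by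
        rw [← real_inner_self_eq_norm_sq, ← hPsymm]
        change _ = inner ℝ v ((P * P) v)
        rw [starProjection_mul_self]
      have hBv : inner ℝ v (B v) = inner ℝ (P v) (B (P v)) := by
        rw [← hPsymm]
        change _ = inner ℝ v ((P * (B * P)) v)
        rw [hBP, hPB]
      rw [hPv, hBv]
      have h5 := abs_le.mp (abs_real_inner_le_norm (P v) (B (P v)))
      have h6 := hnB (P v)
      nlinarith [norm_nonneg (P v)]
    rw [h2]
    linarith
  have hpd := planeDistSq_eq_trace T S
  have hnn := planeDistSq_nonneg T S
  rw [hST] at hpd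
  rw [hsplit]
  have h7 : (Module.finrank ℝ T : ℝ) - clmTrace (Q * P) = planeDistSq T S / 2 := by
    rw [hpd]; ring
  rw [h7] at hlin ⊢
  nlinarith

end Trace

/-! ### Graphs in a product of Euclidean spaces -/

section Graph

variable {X Y : Type*} [NormedAddCommGroup X] [InnerProductSpace ℝ X]
  [NormedAddCommGroup Y] [InnerProductSpace ℝ Y]

/-- The parametrization `x ↦ (x, g x)` of the graph of `g`. -/
def graphMap (g : X → Y) (x : X) : WithLp 2 (X × Y) :=
  WithLp.toLp 2 (x, g x)

/-- The linear map `a ↦ (a, Dg(x) a)`, the derivative of `graphMap g`. -/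
def graphDeriv (g : X → Y) (x : X) : X →L[ℝ] WithLp 2 (X × Y) :=
  ((WithLp.prodContinuousLinearEquiv 2 ℝ X Y).symm : X × Y →L[ℝ] WithLp 2 (X × Y)) ∘L
    (ContinuousLinearMap.id ℝ X).prod (fderiv ℝ g x)

/-- The inclusion `y ↦ (0, y)`. -/
def verticalInclusion (X Y : Type*) [NormedAddCommGroup X] [InnerProductSpace ℝ X]
    [NormedAddCommGroup Y] [InnerProductSpace ℝ Y] : Y →L[ℝ] WithLp 2 (X × Y) :=
  ((WithLp.prodContinuousLinearEquiv 2 ℝ X Y).symm : X × Y →L[ℝ] WithLp 2 (X × Y)) ∘L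
    ContinuousLinearMap.inr ℝ X Y

@[simp] theorem graphMap_fst (g : X → Y) (x : X) : (graphMap g x).fst = x := rfl

@[simp] theorem graphMap_snd (g : X → Y) (x : X) : (graphMap g x).snd = g x := rfl

@[simp] theorem graphDeriv_fst (g : X → Y) (x a : X) : (graphDeriv g x a).fst = a := rfl

@[simp] theorem graphDeriv_snd (g : X → Y) (x a : X) :
    (graphDeriv g x a).snd = fderiv ℝ g x a := rfl

@[simp] theorem verticalInclusion_fst (y : Y) : (verticalInclusion X Y y).fst = 0 := rfl

@[simp] theorem verticalInclusion_snd (y : Y) : (verticalInclusion X Y y).snd = y := rfl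

theorem WithLp.prod_ext {z w : WithLp 2 (X × Y)} (h₁ : z.fst = w.fst) (h₂ : z.snd = w.snd) : z = w :=
  (WithLp.ofLp_injective 2) (Prod.ext h₁ h₂)

theorem WithLp.prod_inner_eq (z w : WithLp 2 (X × Y)) :
    inner ℝ z w = inner ℝ z.fst w.fst + inner ℝ z.snd w.snd :=
  WithLp.prod_inner_apply z w

theorem WithLp.prod_norm_sq_eq (z : WithLp 2 (X × Y)) : ‖z‖ ^ 2 = ‖z.fst‖ ^ 2 + ‖z.snd‖ ^ 2 :=
  WithLp.prod_norm_sq_eq_of_L2 z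

theorem WithLp.prod_norm_fst_le (z : WithLp 2 (X × Y)) : ‖z.fst‖ ≤ ‖z‖ := by
  refine abs_le_of_sq_le_sq' ?_ (norm_nonneg _) |>.2
  rw [WithLp.prod_norm_sq_eq]
  linarith [sq_nonneg ‖z.snd‖]

theorem WithLp.prod_norm_snd_le (z : WithLp 2 (X × Y)) : ‖z.snd‖ ≤ ‖z‖ := by
  refine abs_le_of_sq_le_sq' ?_ (norm_nonneg _) |>.2
  rw [WithLp.prod_norm_sq_eq]
  linarith [sq_nonneg ‖z.fst‖]

theorem WithLp.prod_norm_le_add (z : WithLp 2 (X × Y)) : ‖z‖ ≤ ‖z.fst‖ + ‖z.snd‖ := by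
  refine abs_le_of_sq_le_sq' ?_ (by positivity) |>.2
  rw [WithLp.prod_norm_sq_eq]
  nlinarith [norm_nonneg z.fst, norm_nonneg z.snd]

theorem WithLp.prod_contDiff_fst {k : WithTop ℕ∞} :
    ContDiff ℝ k (fun z : WithLp 2 (X × Y) => z.fst) := (WithLp.fstL 2 ℝ X Y).contDiff

theorem WithLp.prod_contDiff_snd {k : WithTop ℕ∞} :
    ContDiff ℝ k (fun z : WithLp 2 (X × Y) => z.snd) := (WithLp.sndL 2 ℝ X Y).contDiff

theorem WithLp.prod_continuous_fst : Continuous (fun z : WithLp 2 (X × Y) => z.fst) :=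
  (WithLp.fstL 2 ℝ X Y).continuous

theorem WithLp.prod_continuous_snd : Continuous (fun z : WithLp 2 (X × Y) => z.snd) :=
  (WithLp.sndL 2 ℝ X Y).continuous

theorem WithLp.prod_hasFDerivAt_fst (z : WithLp 2 (X × Y)) :
    HasFDerivAt (fun z : WithLp 2 (X × Y) => z.fst) (WithLp.fstL 2 ℝ X Y) z :=
  (WithLp.fstL 2 ℝ X Y).hasFDerivAt

theorem WithLp.prod_hasFDerivAt_snd (z : WithLp 2 (X × Y)) :
    HasFDerivAt (fun z : WithLp 2 (X × Y) => z.snd) (WithLp.sndL 2 ℝ X Y) z :=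
  (WithLp.sndL 2 ℝ X Y).hasFDerivAt

theorem HasFDerivAt.prod_fst {G : Type*} [NormedAddCommGroup G] [NormedSpace ℝ G]
    {f : G → WithLp 2 (X × Y)} {f' : G →L[ℝ] WithLp 2 (X × Y)} {x : G} (h : HasFDerivAt f f' x) :
    HasFDerivAt (fun y => (f y).fst) ((WithLp.fstL 2 ℝ X Y) ∘L f') x :=
  (WithLp.fstL 2 ℝ X Y).hasFDerivAt.comp x h

theorem HasFDerivAt.prod_snd {G : Type*} [NormedAddCommGroup G] [NormedSpace ℝ G]
    {f : G → WithLp 2 (X × Y)} {f' : G →L[ℝ] WithLp 2 (X × Y)} {x : G} (h : HasFDerivAt f f' x) :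
    HasFDerivAt (fun y => (f y).snd) ((WithLp.sndL 2 ℝ X Y) ∘L f') x :=
  (WithLp.sndL 2 ℝ X Y).hasFDerivAt.comp x h

theorem contDiff_toLp {k : WithTop ℕ∞} :
    ContDiff ℝ k (fun z : X × Y => (WithLp.toLp 2 z : WithLp 2 (X × Y))) :=
  ((WithLp.prodContinuousLinearEquiv 2 ℝ X Y).symm : X × Y →L[ℝ] WithLp 2 (X × Y)).contDiff

theorem hasFDerivAt_graphMap {g : X → Y} {x : X} (hg : DifferentiableAt ℝ g x) :
    HasFDerivAt (graphMap g) (graphDeriv g x) x :=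
  ((WithLp.prodContinuousLinearEquiv 2 ℝ X Y).symm : X × Y →L[ℝ] WithLp 2 (X × Y)).hasFDerivAt.comp x
    ((hasFDerivAt_id x).prodMk hg.hasFDerivAt)

theorem contDiffAt_graphMap {g : X → Y} {x : X} {k : WithTop ℕ∞} (hg : ContDiffAt ℝ k g x) :
    ContDiffAt ℝ k (graphMap g) x :=
  contDiff_toLp.contDiffAt.comp x (contDiffAt_id.prodMk hg)

theorem graphDeriv_injective (g : X → Y) (x : X) : Function.Injective (graphDeriv g x) :=
  fun a b h => by simpa using congrArg WithLp.fst h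

theorem finrank_range_graphDeriv (g : X → Y) (x : X) :
    Module.finrank ℝ (LinearMap.range (graphDeriv g x).toLinearMap) = Module.finrank ℝ X :=
  LinearMap.finrank_range_of_inj (graphDeriv_injective g x)

/-- One inclusion: the derivative of w.snd - g(w.fst), which vanishes on the graph, kills the
tangent cone. The other: the parametrization carries the tangent cone of the open ball, which is
everything, into that of the graph. -/
theorem tangentPlane_graph {g : X → Y} {r : ℝ} {x : X} (hx : ‖x‖ < r)
    (hg : DifferentiableAt ℝ g x) :
    tangentPlane {z : WithLp 2 (X × Y) | ‖z.fst‖ < r ∧ z.snd = g z.fst} (graphMap g x) =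
      LinearMap.range (graphDeriv g x).toLinearMap := by
  set M := {z : WithLp 2 (X × Y) | ‖z.fst‖ < r ∧ z.snd = g z.fst}
  apply le_antisymm
  · refine Submodule.span_le.mpr fun u hu => ?_
    have hΦ : HasFDerivAt (fun w : WithLp 2 (X × Y) => w.snd - g w.fst)
        (WithLp.sndL 2 ℝ X Y - (fderiv ℝ g x) ∘L WithLp.fstL 2 ℝ X Y) (graphMap g x) := by
      have h1 : HasFDerivAt g (fderiv ℝ g x) (graphMap g x : WithLp 2 (X × Y)).fst := hg.hasFDerivAt
      exact (WithLp.prod_hasFDerivAt_snd _).sub (h1.comp _ (WithLp.prod_hasFDerivAt_fst _))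
    have h0 : HasFDerivWithinAt (fun w : WithLp 2 (X × Y) => w.snd - g w.fst)
        (0 : WithLp 2 (X × Y) →L[ℝ] Y) M (graphMap g x) := by
      refine (hasFDerivWithinAt_const (0 : Y) _ _).congr (fun w hw => ?_) (by simp)
      rw [hw.2, sub_self]
    have h2 := hΦ.hasFDerivWithinAt.unique_on h0 hu
    refine ⟨u.fst, WithLp.prod_ext rfl ?_⟩
    have h3 : u.snd - fderiv ℝ g x u.fst = 0 := h2
    exact (sub_eq_zero.mp h3).symm
  · rintro _ ⟨a, rfl⟩
    refine Submodule.subset_span ?_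
    have h1 := (hasFDerivAt_graphMap hg).hasFDerivWithinAt (s := Metric.ball 0 r)
    have h2 : tangentConeAt ℝ (Metric.ball (0 : X) r) x = univ :=
      tangentConeAt_of_mem_nhds (Metric.isOpen_ball.mem_nhds (by simpa using hx))
    have h3 := h1.mapsTo_tangent_cone (h2 ▸ mem_univ a)
    refine tangentConeAt_mono ?_ h3
    rintro _ ⟨y, hy, rfl⟩
    exact ⟨by simpa using hy, rfl⟩

variable [FiniteDimensional ℝ X] [FiniteDimensional ℝ Y]

/-- A differentiable map whose graph is a smooth submanifold is smooth. -/
theorem contDiffOn_of_isSmoothSubmanifold_graph {g : X → Y} {r : ℝ}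
    {M : Set (WithLp 2 (X × Y))} (hMg : M = {z | ‖z.fst‖ < r ∧ z.snd = g z.fst})
    (hM : ∀ q ∈ M, ∃ Ψ : OpenPartialHomeomorph (WithLp 2 (X × Y)) (WithLp 2 (X × Y)),
      q ∈ Ψ.source ∧ ContDiffOn ℝ ∞ Ψ Ψ.source ∧ ContDiffOn ℝ ∞ Ψ.symm Ψ.target ∧
        ∀ w ∈ Ψ.source, w ∈ M ↔ (Ψ w).snd = 0)
    (hg : DifferentiableOn ℝ g (Metric.ball 0 r)) : ContDiffOn ℝ ∞ g (Metric.ball 0 r) := by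
  intro x hx
  refine ContDiffAt.contDiffWithinAt ?_
  have hmem : ∀ y ∈ Metric.ball (0 : X) r, graphMap g y ∈ M := fun y hy => by
    rw [hMg]
    exact ⟨by simpa using hy, rfl⟩
  have hball : Metric.ball (0 : X) r ∈ 𝓝 x := Metric.isOpen_ball.mem_nhds hx
  have hgx : DifferentiableAt ℝ g x := hg.differentiableAt hball
  set q : WithLp 2 (X × Y) := graphMap g x with hq
  obtain ⟨Ψ, hqs, hΨ, hΨ', hiff⟩ := hM q (hmem x hx)
  have hsrc : Ψ.source ∈ 𝓝 q := Ψ.open_source.mem_nhds hqs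
  have hΨq : ContDiffAt ℝ ∞ Ψ q := hΨ.contDiffAt hsrc
  have hΨq' : ContDiffAt ℝ ∞ Ψ.symm (Ψ q) :=
    hΨ'.contDiffAt (Ψ.open_target.mem_nhds (Ψ.map_source hqs))
  have hne : (∞ : WithTop ℕ∞) ≠ 0 := by simp
  set D := fderiv ℝ Ψ q
  have hD : HasFDerivAt Ψ D q := (hΨq.differentiableAt hne).hasFDerivAt
  have hDinj : Function.Injective D := by
    have h1 : HasFDerivAt (Ψ.symm ∘ Ψ) ((fderiv ℝ Ψ.symm (Ψ q)) ∘L D) q :=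
      (hΨq'.differentiableAt hne).hasFDerivAt.comp q hD
    have h2 : HasFDerivAt (Ψ.symm ∘ Ψ) (ContinuousLinearMap.id ℝ _) q :=
      (hasFDerivAt_id q).congr_of_eventuallyEq (Ψ.eventually_left_inverse hqs)
    have h3 := h1.unique h2
    intro u v huv
    have h4 := congrArg (fun A : WithLp 2 (X × Y) →L[ℝ] WithLp 2 (X × Y) => A u) h3
    have h5 := congrArg (fun A : WithLp 2 (X × Y) →L[ℝ] WithLp 2 (X × Y) => A v) h3
    simp only [ContinuousLinearMap.comp_apply, ContinuousLinearMap.id_apply] at h4 h5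
    rw [← h4, ← h5, huv]
  -- Ψ flattens M, so its derivative sends tangent vectors of the graph to horizontal vectors.
  have htan : ∀ a, (D (graphDeriv g x a)).snd = 0 := by
    intro a
    have hF := hasFDerivAt_graphMap hgx
    have h1 : HasFDerivAt (fun y => (Ψ (graphMap g y)).snd)
        ((WithLp.sndL 2 ℝ X Y) ∘L (D ∘L graphDeriv g x)) x :=
      HasFDerivAt.prod_snd (hD.comp x hF)
    have h2 : HasFDerivAt (fun y => (Ψ (graphMap g y)).snd) (0 : X →L[ℝ] Y) x := by
      refine (hasFDerivAt_const (0 : Y) x).congr_of_eventuallyEq ?_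
      filter_upwards [hF.continuousAt hsrc, hball] with y hy hyb
      exact (hiff _ hy).mp (hmem y hyb)
    exact congrArg (fun A : X →L[ℝ] Y => A a) (h1.unique h2)
  -- By dimension count D maps the tangent space onto all horizontal vectors. A vertical vector sent
  -- to a horizontal one is therefore tangent to the graph, hence zero.
  have hker : ∀ y : Y, (D (verticalInclusion X Y y)).snd = 0 → y = 0 := by
    intro y hy
    let J : X →ₗ[ℝ] X := (WithLp.fstL 2 ℝ X Y).toLinearMap ∘ₗ D.toLinearMap ∘ₗ
      (graphDeriv g x).toLinearMap
    have hJ : Function.Injective J := by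
      intro a b hab
      refine graphDeriv_injective g x (hDinj (WithLp.prod_ext hab ?_))
      rw [htan, htan]
    obtain ⟨a, ha⟩ := (LinearMap.injective_iff_surjective.mp hJ) (D (verticalInclusion X Y y)).fst
    have h1 : graphDeriv g x a = verticalInclusion X Y y :=
      hDinj (WithLp.prod_ext ha (by rw [htan, hy]))
    have h2 : a = 0 := congrArg WithLp.fst h1
    have h3 := congrArg WithLp.snd h1
    rw [h2, map_zero] at h3
    simpa using h3.symm
  -- Keeping x and replacing only the vertical coordinate gives a local diffeomorphism with Φ(y,
  -- g(y)) = (y, 0), so g is read off from its smooth local inverse.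
  let Φ : WithLp 2 (X × Y) → WithLp 2 (X × Y) := fun w => WithLp.toLp 2 (w.fst, (Ψ w).snd)
  have hΦ : ContDiffAt ℝ ∞ Φ q := contDiff_toLp.contDiffAt.comp q
    (WithLp.prod_contDiff_fst.contDiffAt.prodMk (WithLp.prod_contDiff_snd.contDiffAt.comp q hΨq))
  let A : WithLp 2 (X × Y) →L[ℝ] WithLp 2 (X × Y) :=
    ((WithLp.prodContinuousLinearEquiv 2 ℝ X Y).symm : X × Y →L[ℝ] WithLp 2 (X × Y)) ∘L
      (WithLp.fstL 2 ℝ X Y).prod ((WithLp.sndL 2 ℝ X Y) ∘L D)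
  have hA : HasFDerivAt Φ A q :=
    ((WithLp.prodContinuousLinearEquiv 2 ℝ X Y).symm : X × Y →L[ℝ] WithLp 2 (X × Y)).hasFDerivAt.comp q
      ((WithLp.prod_hasFDerivAt_fst q).prodMk hD.prod_snd)
  have hAinj : Function.Injective A := by
    refine (injective_iff_map_eq_zero A).mpr fun u hu => ?_
    have h1 : u.fst = 0 := congrArg WithLp.fst hu
    have h2 : (D u).snd = 0 := congrArg WithLp.snd hu
    have h3 : u = verticalInclusion X Y u.snd := WithLp.prod_ext h1 rfl
    rw [h3] at h2
    rw [h3, hker _ h2, map_zero]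
  let A' : WithLp 2 (X × Y) ≃L[ℝ] WithLp 2 (X × Y) :=
    (LinearEquiv.ofInjectiveEndo A.toLinearMap hAinj).toContinuousLinearEquiv
  have hA' : HasFDerivAt Φ (A' : WithLp 2 (X × Y) →L[ℝ] WithLp 2 (X × Y)) q := by
    have h : (A' : WithLp 2 (X × Y) →L[ℝ] WithLp 2 (X × Y)) = A := by
      ext1 u
      rfl
    rwa [h]
  have hinv := hΦ.to_localInverse hA' hne
  have hleft : ∀ᶠ w in 𝓝 q, hΦ.localInverse hA' hne (Φ w) = w :=
    (hΦ.hasStrictFDerivAt' hA' hne).eventually_left_inverse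
  have hΦq : Φ q = WithLp.toLp 2 (x, (0 : Y)) := by
    refine WithLp.prod_ext rfl ?_
    exact (hiff q hqs).mp (hmem x hx)
  have hsm : ContDiffAt ℝ ∞
      (fun y : X => (hΦ.localInverse hA' hne (WithLp.toLp 2 (y, (0 : Y)))).snd) x := by
    refine WithLp.prod_contDiff_snd.contDiffAt.comp x (ContDiffAt.comp x ?_
      (contDiff_toLp.contDiffAt.comp x (contDiffAt_id.prodMk contDiffAt_const)))
    rw [← hΦq]
    exact hinv
  refine hsm.congr_of_eventuallyEq ?_
  have hF := (hasFDerivAt_graphMap hgx).continuousAt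
  filter_upwards [hF hleft, hF hsrc, hball] with y hy hys hyb
  have h1 : Φ (graphMap g y) = WithLp.toLp 2 (y, (0 : Y)) := by
    refine WithLp.prod_ext rfl ?_
    exact (hiff _ hys).mp (hmem y hyb)
  have h2 : hΦ.localInverse hA' hne (Φ (graphMap g y)) = graphMap g y := hy
  rw [← h1, h2, graphMap_snd]

end Graph

/-! ### Closest points on a flat graph -/

section ClosestPoint

theorem isClosestPoint_iff {E : Type*} [NormedAddCommGroup E] [InnerProductSpace ℝ E]
    [FiniteDimensional ℝ E] {M : Set E} {z q : E} :
    IsClosestPoint M z q ↔ q ∈ M ∧ ∀ q' ∈ M, dist z q ≤ dist z q' := by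
  refine and_congr_right fun hq => ?_
  constructor
  · intro h q' hq'
    rw [h]
    exact Metric.infDist_le_dist_of_mem hq'
  · intro h
    exact le_antisymm ((Metric.le_infDist ⟨q, hq⟩).mpr fun {y} hy => h y hy)
      (Metric.infDist_le_dist_of_mem hq)

theorem isClosestPoint_closestPoint {E : Type*} [NormedAddCommGroup E] [InnerProductSpace ℝ E]
    [FiniteDimensional ℝ E] {M : Set E} {z : E} (h : ∃ q, IsClosestPoint M z q) :
    IsClosestPoint M z (closestPoint M z) := by
  rw [closestPoint, dif_pos h]
  exact h.choose_spec

variable {X Y : Type*} [NormedAddCommGroup X] [InnerProductSpace ℝ X] [FiniteDimensional ℝ X]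
  [NormedAddCommGroup Y] [InnerProductSpace ℝ Y] [FiniteDimensional ℝ Y]

/-- The real adjoint as a continuous linear map. -/
def adjointCLM (X Y : Type*) [NormedAddCommGroup X] [InnerProductSpace ℝ X] [FiniteDimensional ℝ X]
    [NormedAddCommGroup Y] [InnerProductSpace ℝ Y] [FiniteDimensional ℝ Y] :
    (X →L[ℝ] Y) →L[ℝ] (Y →L[ℝ] X) :=
  LinearMap.toContinuousLinearMap
    { toFun := fun A => ContinuousLinearMap.adjoint A
      map_add' := fun A B => map_add _ A B
      map_smul' := fun c A => by simp }

theorem inner_adjointCLM (A : X →L[ℝ] Y) (a : X) (y : Y) :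
    inner ℝ a (adjointCLM X Y A y) = inner ℝ (A a) y :=
  ContinuousLinearMap.adjoint_inner_right A a y

theorem norm_adjointCLM (A : X →L[ℝ] Y) : ‖adjointCLM X Y A‖ = ‖A‖ :=
  LinearIsometryEquiv.norm_map ContinuousLinearMap.adjoint A

/-- `g : X → Y` is smooth and small in `C²` on the ball of radius `2`. -/
structure IsSmallGraph (g : X → Y) (δ : ℝ) : Prop where
  contDiffOn : ContDiffOn ℝ ∞ g (Metric.ball 0 2)
  nonneg : 0 ≤ δ
  le : δ ≤ 1 / 20
  norm_le : ∀ x, ‖x‖ < 2 → ‖g x‖ ≤ 2 * δ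
  norm_fderiv_le : ∀ x, ‖x‖ < 2 → ‖fderiv ℝ g x‖ ≤ δ
  norm_fderiv_fderiv_le : ∀ x, ‖x‖ < 2 → ‖fderiv ℝ (fderiv ℝ g) x‖ ≤ δ / 2

/-- The graph of `g` over the ball of radius `2`. -/
def graphOver (g : X → Y) : Set (WithLp 2 (X × Y)) := {z | ‖z.fst‖ < 2 ∧ z.snd = g z.fst}

/-- The points `(x, y)` with `|x| < 3 / 2` and `|y| < 3 / 2`. -/
def largeSlab (X Y : Type*) [NormedAddCommGroup X] [NormedAddCommGroup Y] :
    Set (WithLp 2 (X × Y)) := {z | ‖z.fst‖ < 3 / 2 ∧ ‖z.snd‖ < 3 / 2}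

/-- `(x, ν) ↦ (x, g x) + (-Dg(x)ᵀ ν, ν)`, which maps normal vectors of the graph, parametrized by
their vertical component, to points of the ambient space. -/
def normalMap (g : X → Y) (w : WithLp 2 (X × Y)) : WithLp 2 (X × Y) :=
  w + WithLp.toLp 2 (-(adjointCLM X Y (fderiv ℝ g w.fst) w.snd), g w.fst)

theorem isOpen_largeSlab : IsOpen (largeSlab X Y) :=
  (isOpen_lt WithLp.prod_continuous_fst.norm continuous_const).inter
    (isOpen_lt WithLp.prod_continuous_snd.norm continuous_const)

namespace IsSmallGraph

variable {g : X → Y} {δ : ℝ}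

theorem contDiffAt (hg : IsSmallGraph g δ) {x : X} (hx : ‖x‖ < 2) : ContDiffAt ℝ ∞ g x :=
  hg.contDiffOn.contDiffAt (Metric.isOpen_ball.mem_nhds (by simpa using hx))

theorem differentiableAt (hg : IsSmallGraph g δ) {x : X} (hx : ‖x‖ < 2) : DifferentiableAt ℝ g x :=
  (hg.contDiffAt hx).differentiableAt (by simp)

theorem contDiffAt_fderiv (hg : IsSmallGraph g δ) {x : X} (hx : ‖x‖ < 2) :
    ContDiffAt ℝ ∞ (fderiv ℝ g) x :=
  (hg.contDiffAt hx).fderiv_right (m := ∞) (by simp)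

theorem norm_sub_le (hg : IsSmallGraph g δ) {x y : X} (hx : ‖x‖ < 2) (hy : ‖y‖ < 2) :
    ‖g x - g y‖ ≤ δ * ‖x - y‖ :=
  (convex_ball (0 : X) 2).norm_image_sub_le_of_norm_fderiv_le
    (fun z hz => hg.differentiableAt (by simpa using hz))
    (fun z hz => hg.norm_fderiv_le z (by simpa using hz)) (by simpa using hy) (by simpa using hx)

theorem norm_fderiv_sub_le (hg : IsSmallGraph g δ) {x y : X} (hx : ‖x‖ < 2) (hy : ‖y‖ < 2) :
    ‖fderiv ℝ g x - fderiv ℝ g y‖ ≤ δ / 2 * ‖x - y‖ :=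
  (convex_ball (0 : X) 2).norm_image_sub_le_of_norm_fderiv_le
    (fun z hz => (hg.contDiffAt_fderiv (by simpa using hz)).differentiableAt (by simp))
    (fun z hz => hg.norm_fderiv_fderiv_le z (by simpa using hz))
    (by simpa using hy) (by simpa using hx)

/-- The three contributions are |D²g| |w.snd| ≤ (δ/2)·2, |Dg| ≤ δ and the Lipschitz constant δ of g.
Splitting the product difference this way needs a vertical bound for only one of the two points. -/
theorem norm_normalMap_sub_le (hg : IsSmallGraph g δ) {w w' : WithLp 2 (X × Y)}
    (h₁ : ‖w.fst‖ < 2) (h₂ : ‖w.snd‖ < 2) (h₁' : ‖w'.fst‖ < 2) :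
    ‖(normalMap g w - w) - (normalMap g w' - w')‖ ≤ 3 * δ * ‖w - w'‖ := by
  refine (WithLp.prod_norm_le_add _).trans ?_
  have hx : ‖w.fst - w'.fst‖ ≤ ‖w - w'‖ := WithLp.prod_norm_fst_le (w - w')
  have hy : ‖w.snd - w'.snd‖ ≤ ‖w - w'‖ := WithLp.prod_norm_snd_le (w - w')
  have hδ := hg.nonneg
  have e1 : ((normalMap g w - w) - (normalMap g w' - w')).fst =
      -((adjointCLM X Y (fderiv ℝ g w.fst - fderiv ℝ g w'.fst)) w.snd
        + adjointCLM X Y (fderiv ℝ g w'.fst) (w.snd - w'.snd)) := by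
    simp only [normalMap, add_sub_cancel_left, map_sub, sub_apply]
    change -_ - -_ = _
    abel
  have e2 : ((normalMap g w - w) - (normalMap g w' - w')).snd = g w.fst - g w'.fst := by
    simp only [normalMap, add_sub_cancel_left]
    rfl
  rw [e1, e2, norm_neg]
  have b1 : ‖(adjointCLM X Y (fderiv ℝ g w.fst - fderiv ℝ g w'.fst)) w.snd‖ ≤
      δ / 2 * ‖w - w'‖ * 2 := by
    refine (ContinuousLinearMap.le_opNorm _ _).trans ?_
    rw [norm_adjointCLM]
    refine mul_le_mul ((hg.norm_fderiv_sub_le h₁ h₁').trans ?_) h₂.le (norm_nonneg _)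
      (by positivity)
    gcongr
  have b2 : ‖adjointCLM X Y (fderiv ℝ g w'.fst) (w.snd - w'.snd)‖ ≤ δ * ‖w - w'‖ := by
    refine (ContinuousLinearMap.le_opNorm _ _).trans ?_
    rw [norm_adjointCLM]
    exact mul_le_mul (hg.norm_fderiv_le _ h₁') hy (norm_nonneg _) hδ
  have b3 : ‖g w.fst - g w'.fst‖ ≤ δ * ‖w - w'‖ :=
    (hg.norm_sub_le h₁ h₁').trans (by gcongr)
  linarith [norm_add_le ((adjointCLM X Y (fderiv ℝ g w.fst - fderiv ℝ g w'.fst)) w.snd)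
    (adjointCLM X Y (fderiv ℝ g w'.fst) (w.snd - w'.snd))]

theorem normalMap_injective (hg : IsSmallGraph g δ) {w w' : WithLp 2 (X × Y)}
    (h₁ : ‖w.fst‖ < 2) (h₂ : ‖w.snd‖ < 2) (h₁' : ‖w'.fst‖ < 2)
    (h : normalMap g w = normalMap g w') : w = w' := by
  have h3 := hg.norm_normalMap_sub_le h₁ h₂ h₁'
  rw [h, sub_sub_sub_cancel_left, norm_sub_rev] at h3
  have h4 : 3 * δ * ‖w - w'‖ ≤ 3 * (1 / 20) * ‖w - w'‖ := by
    gcongr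
    exact hg.le
  have h5 : ‖w - w'‖ = 0 := le_antisymm (by linarith [norm_nonneg (w - w')]) (norm_nonneg _)
  exact sub_eq_zero.mp (norm_eq_zero.mp h5)

theorem contDiffAt_normalMap (hg : IsSmallGraph g δ) {w : WithLp 2 (X × Y)} (h₁ : ‖w.fst‖ < 2) :
    ContDiffAt ℝ ∞ (normalMap g) w := by
  have hf : ContDiffAt ℝ ∞ (fun w : WithLp 2 (X × Y) => w.fst) w :=
    WithLp.prod_contDiff_fst.contDiffAt
  have h1 : ContDiffAt ℝ ∞ (fun w : WithLp 2 (X × Y) => fderiv ℝ g w.fst) w :=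
    ContDiffAt.comp w (hg.contDiffAt_fderiv h₁) hf
  have h2 : ContDiffAt ℝ ∞
      (fun w : WithLp 2 (X × Y) => adjointCLM X Y (fderiv ℝ g w.fst) w.snd) w :=
    ((adjointCLM X Y).contDiff.contDiffAt.comp w h1).clm_apply WithLp.prod_contDiff_snd.contDiffAt
  exact contDiffAt_id.add (contDiff_toLp.contDiffAt.comp w
    (h2.neg.prodMk (ContDiffAt.comp w (hg.contDiffAt h₁) hf)))

/-- The Lipschitz bound passes to the derivative, which is within 3δ < 1 of the identity and hence
invertible. -/
theorem exists_equiv_hasFDerivAt_normalMap (hg : IsSmallGraph g δ) {w : WithLp 2 (X × Y)}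
    (h₁ : ‖w.fst‖ < 2) (h₂ : ‖w.snd‖ < 2) :
    ∃ A : WithLp 2 (X × Y) ≃L[ℝ] WithLp 2 (X × Y),
      HasFDerivAt (normalMap g) (A : WithLp 2 (X × Y) →L[ℝ] WithLp 2 (X × Y)) w := by
  set A := fderiv ℝ (normalMap g) w
  have hA : HasFDerivAt (normalMap g) A w :=
    ((hg.contDiffAt_normalMap h₁).differentiableAt (by simp)).hasFDerivAt
  have hδ := hg.nonneg
  have hbd : ‖A - ContinuousLinearMap.id ℝ _‖ ≤ 3 * δ := by
    refine HasFDerivAt.le_of_lip' (hA.sub (hasFDerivAt_id w)) (by positivity) ?_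
    have hw : ∀ᶠ w' in 𝓝 w, ‖WithLp.fst w'‖ < 2 ∧ ‖WithLp.snd w'‖ < 2 :=
      (WithLp.prod_continuous_fst.norm.continuousAt.eventually_lt continuousAt_const h₁).and
        (WithLp.prod_continuous_snd.norm.continuousAt.eventually_lt continuousAt_const h₂)
    filter_upwards [hw] with w' hw'
    exact hg.norm_normalMap_sub_le hw'.1 hw'.2 h₁
  have hinj : Function.Injective A := by
    refine (injective_iff_map_eq_zero A).mpr fun u hu => ?_
    have h3 := (A - ContinuousLinearMap.id ℝ _).le_of_opNorm_le hbd u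
    simp only [sub_apply, hu, ContinuousLinearMap.id_apply, zero_sub,
      norm_neg] at h3
    have h4 : 3 * δ * ‖u‖ ≤ 3 * (1 / 20) * ‖u‖ := by
      gcongr
      exact hg.le
    exact norm_eq_zero.mp (le_antisymm (by linarith [norm_nonneg u]) (norm_nonneg _))
  refine ⟨(LinearEquiv.ofInjectiveEndo A.toLinearMap hinj).toContinuousLinearEquiv, ?_⟩
  have h : ((LinearEquiv.ofInjectiveEndo A.toLinearMap hinj).toContinuousLinearEquiv :
      WithLp 2 (X × Y) →L[ℝ] WithLp 2 (X × Y)) = A := by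
    ext1 u
    rfl
  rwa [h]

/-- With t = |x - z.fst|, s = |z.snd - g x| and c = |z.snd - g z.fst| < 2, comparison of distances
gives t² + s² ≤ c², while c ≤ s + δt gives c² ≤ s² + 2cδt. Hence t² ≤ 4δt, and s ≤ c. -/
theorem norm_sub_fst_le (hg : IsSmallGraph g δ) {z : WithLp 2 (X × Y)} (hz : z ∈ largeSlab X Y)
    {x : X} (hx : ‖x‖ < 2) (h : dist z (graphMap g x) ≤ dist z (graphMap g z.fst)) :
    ‖x - z.fst‖ ≤ 4 * δ ∧ ‖z.snd - g x‖ < 2 := by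
  have hz2 : ‖z.fst‖ < 2 := by linarith [hz.1]
  have hδ := hg.nonneg
  have hδ' := hg.le
  have hsq : ‖z - graphMap g x‖ ^ 2 ≤ ‖z - graphMap g z.fst‖ ^ 2 := by
    rw [← dist_eq_norm, ← dist_eq_norm]
    gcongr
  rw [WithLp.prod_norm_sq_eq, WithLp.prod_norm_sq_eq] at hsq
  change ‖z.fst - x‖ ^ 2 + ‖z.snd - g x‖ ^ 2 ≤ ‖z.fst - z.fst‖ ^ 2 + ‖z.snd - g z.fst‖ ^ 2 at hsq
  rw [sub_self, norm_zero, norm_sub_rev] at hsq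
  have hlip := hg.norm_sub_le hx hz2
  have hc : ‖z.snd - g z.fst‖ < 2 := by
    have := hg.norm_le _ hz2
    linarith [_root_.norm_sub_le z.snd (g z.fst), hz.2]
  have htri : ‖z.snd - g z.fst‖ ≤ ‖z.snd - g x‖ + δ * ‖x - z.fst‖ := by
    have := norm_add_le (z.snd - g x) (g x - g z.fst)
    rw [sub_add_sub_cancel] at this
    linarith
  set c := ‖z.snd - g z.fst‖
  set s := ‖z.snd - g x‖
  set t := ‖x - z.fst‖
  have hc0 : 0 ≤ c := norm_nonneg _
  have hs0 : 0 ≤ s := norm_nonneg _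
  have ht0 : 0 ≤ t := norm_nonneg _
  constructor
  · by_contra! hlt
    have h1 : c ^ 2 ≤ s ^ 2 + 2 * c * (δ * t) := by
      nlinarith [sq_nonneg (c - s), mul_nonneg hc0 (sub_nonneg.mpr htri)]
    have h2 : c * (δ * t) ≤ 2 * (δ * t) := by gcongr
    nlinarith
  · nlinarith

theorem inner_sub_graphMap_eq_zero (hg : IsSmallGraph g δ) {z : WithLp 2 (X × Y)} {x : X}
    (hx : ‖x‖ < 2) (h : IsClosestPoint (graphOver g) z (graphMap g x)) (a : X) :
    inner ℝ (z - graphMap g x) (graphDeriv g x a) = 0 := by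
  have hmin : IsLocalMin (fun y => ‖z - graphMap g y‖ ^ 2) x := by
    filter_upwards [Metric.isOpen_ball.mem_nhds (show x ∈ Metric.ball (0 : X) 2 by simpa using hx)]
      with y hy
    have := (isClosestPoint_iff.mp h).2 (graphMap g y) ⟨by simpa using hy, rfl⟩
    rw [dist_eq_norm, dist_eq_norm] at this
    gcongr
  have hd := ((hasFDerivAt_graphMap (hg.differentiableAt hx)).const_sub z).norm_sq
  have h0 := congrArg (fun A : X →L[ℝ] ℝ => A a) (hmin.hasFDerivAt_eq_zero hd)
  have h1 : 2 • inner ℝ (z - graphMap g x) (-(graphDeriv g x a)) = 0 := h0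
  rw [inner_neg_right] at h1
  simp only [nsmul_eq_mul, Nat.cast_ofNat] at h1
  linarith

/-- By the first-order condition z - F(x) is normal, and a normal vector with vertical component y
has horizontal component -Dg(x)ᵀ y. -/
theorem normalMap_of_isClosestPoint (hg : IsSmallGraph g δ) {z : WithLp 2 (X × Y)} {x : X}
    (hx : ‖x‖ < 2) (h : IsClosestPoint (graphOver g) z (graphMap g x)) :
    normalMap g (WithLp.toLp 2 (x, z.snd - g x)) = z := by
  refine WithLp.prod_ext ?_ ?_
  · change x + -(adjointCLM X Y (fderiv ℝ g x) (z.snd - g x)) = z.fst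
    refine ext_inner_left ℝ fun a => ?_
    have h1 := hg.inner_sub_graphMap_eq_zero hx h a
    rw [WithLp.prod_inner_eq] at h1
    change inner ℝ (z.fst - x) a + inner ℝ (z.snd - g x) (fderiv ℝ g x a) = 0 at h1
    rw [inner_add_right, inner_neg_right, inner_adjointCLM, real_inner_comm (z.snd - g x)]
    rw [inner_sub_left, real_inner_comm a z.fst, real_inner_comm a x] at h1
    linarith
  · change z.snd - g x + g x = z.snd
    abel

theorem mem_graphOver_iff {q : WithLp 2 (X × Y)} :
    q ∈ graphOver g ↔ ‖q.fst‖ < 2 ∧ q = graphMap g q.fst :=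
  and_congr_right fun _ => ⟨fun h => WithLp.prod_ext rfl h, fun h => congrArg WithLp.snd h⟩

theorem norm_of_isClosestPoint (hg : IsSmallGraph g δ) {z : WithLp 2 (X × Y)}
    (hz : z ∈ largeSlab X Y) {q : WithLp 2 (X × Y)} (h : IsClosestPoint (graphOver g) z q) :
    ‖q.fst - z.fst‖ ≤ 4 * δ ∧ ‖z.snd - g q.fst‖ < 2 := by
  obtain ⟨h1, h2⟩ := mem_graphOver_iff.mp h.1
  refine hg.norm_sub_fst_le hz h1 ?_
  rw [← h2]
  exact (isClosestPoint_iff.mp h).2 _ ⟨by simpa using (by linarith [hz.1] : ‖z.fst‖ < 2), rfl⟩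

/-- The graph is not closed, so the minimum is taken over a compact ball of base points. Points
outside it cannot do better: competitors lie within 4δ ≤ 1/5 < 1/4 horizontally. -/
theorem exists_isClosestPoint (hg : IsSmallGraph g δ) {z : WithLp 2 (X × Y)}
    (hz : z ∈ largeSlab X Y) : ∃ q, IsClosestPoint (graphOver g) z q := by
  have hsub : ∀ x ∈ Metric.closedBall z.fst (1 / 4), ‖x‖ < 2 := by
    intro x hx
    rw [mem_closedBall_iff_norm] at hx
    have := norm_add_le (x - z.fst) z.fst
    rw [sub_add_cancel] at this
    linarith [hz.1]
  have hcont : ContinuousOn (fun x => dist z (graphMap g x)) (Metric.closedBall z.fst (1 / 4)) :=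
    fun x hx => ContinuousAt.continuousWithinAt (continuousAt_const.dist
      (hasFDerivAt_graphMap (hg.differentiableAt (hsub x hx))).continuousAt)
  obtain ⟨x, hx, hmin⟩ := (isCompact_closedBall z.fst (1 / 4)).exists_isMinOn
    ⟨z.fst, Metric.mem_closedBall_self (by norm_num)⟩ hcont
  refine ⟨graphMap g x, isClosestPoint_iff.mpr ⟨⟨hsub x hx, rfl⟩, fun q' hq' => ?_⟩⟩
  obtain ⟨h1, h2⟩ := mem_graphOver_iff.mp hq'
  rw [h2]
  have hc : dist z (graphMap g x) ≤ dist z (graphMap g z.fst) :=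
    hmin (Metric.mem_closedBall_self (by norm_num))
  by_contra! hlt
  have h3 := (hg.norm_sub_fst_le hz h1 (hlt.le.trans hc)).1
  have h4 : q'.fst ∈ Metric.closedBall z.fst (1 / 4) := by
    rw [mem_closedBall_iff_norm]
    linarith [hg.le]
  exact absurd (hmin h4) (not_le.mpr hlt)

theorem eq_graphMap_of_normalMap_eq (hg : IsSmallGraph g δ) {z q w : WithLp 2 (X × Y)}
    (hq : IsClosestPoint (graphOver g) z q)
    (h₁ : ‖w.fst‖ < 2) (h₂ : ‖w.snd‖ < 2) (hw : normalMap g w = z) : q = graphMap g w.fst := by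
  obtain ⟨h1, h2⟩ := mem_graphOver_iff.mp hq.1
  have h3 : normalMap g (WithLp.toLp 2 (q.fst, z.snd - g q.fst)) = z :=
    hg.normalMap_of_isClosestPoint h1 (h2 ▸ hq)
  have h4 := hg.normalMap_injective (w' := WithLp.toLp 2 (q.fst, z.snd - g q.fst)) h₁ h₂ h1
    (hw.trans h3.symm)
  rw [h4]
  exact h2

theorem existsUnique_isClosestPoint (hg : IsSmallGraph g δ) {z : WithLp 2 (X × Y)}
    (hz : z ∈ largeSlab X Y) : ∃! q, IsClosestPoint (graphOver g) z q := by
  obtain ⟨q, hq⟩ := hg.exists_isClosestPoint hz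
  refine ⟨q, hq, fun q' hq' => ?_⟩
  obtain ⟨h1, h2⟩ := mem_graphOver_iff.mp hq'.1
  have h3 := hg.normalMap_of_isClosestPoint h1 (h2 ▸ hq')
  have h4 := hg.eq_graphMap_of_normalMap_eq (w := WithLp.toLp 2 (q'.fst, z.snd - g q'.fst)) hq h1
    (hg.norm_of_isClosestPoint hz hq').2 h3
  rw [h4]
  exact h2

theorem isClosestPoint_closestPoint (hg : IsSmallGraph g δ) {z : WithLp 2 (X × Y)}
    (hz : z ∈ largeSlab X Y) : IsClosestPoint (graphOver g) z (closestPoint (graphOver g) z) :=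
  _root_.isClosestPoint_closestPoint (hg.exists_isClosestPoint hz)

theorem norm_fst_closestPoint_lt (hg : IsSmallGraph g δ) {z : WithLp 2 (X × Y)}
    (hz : z ∈ largeSlab X Y) : ‖(closestPoint (graphOver g) z).fst‖ < 2 :=
  (hg.isClosestPoint_closestPoint hz).1.1

theorem closestPoint_eq_graphMap (hg : IsSmallGraph g δ) {z : WithLp 2 (X × Y)}
    (hz : z ∈ largeSlab X Y) :
    closestPoint (graphOver g) z = graphMap g (closestPoint (graphOver g) z).fst :=
  (mem_graphOver_iff.mp (hg.isClosestPoint_closestPoint hz).1).2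

theorem infDist_eq_norm (hg : IsSmallGraph g δ) {z : WithLp 2 (X × Y)}
    (hz : z ∈ largeSlab X Y) :
    Metric.infDist z (graphOver g) = ‖z - closestPoint (graphOver g) z‖ := by
  rw [← (hg.isClosestPoint_closestPoint hz).2, dist_eq_norm]

theorem infDist_le_two (hg : IsSmallGraph g δ) {z : WithLp 2 (X × Y)}
    (hz : z ∈ largeSlab X Y) : Metric.infDist z (graphOver g) ≤ 2 := by
  have hz2 : ‖z.fst‖ < 2 := by linarith [hz.1]
  have hmem : graphMap g z.fst ∈ graphOver g := ⟨hz2, rfl⟩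
  refine (Metric.infDist_le_dist_of_mem hmem).trans ?_
  rw [dist_eq_norm]
  refine (WithLp.prod_norm_le_add _).trans ?_
  change ‖z.fst - z.fst‖ + ‖z.snd - g z.fst‖ ≤ 2
  rw [sub_self, norm_zero]
  linarith [_root_.norm_sub_le z.snd (g z.fst), hg.norm_le _ hz2, hg.le, hz.2]

theorem inner_sub_closestPoint_eq_zero (hg : IsSmallGraph g δ) {z : WithLp 2 (X × Y)}
    (hz : z ∈ largeSlab X Y) (a : X) :
    inner ℝ (z - closestPoint (graphOver g) z)
      (graphDeriv g (closestPoint (graphOver g) z).fst a) = 0 := by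
  have h1 := hg.closestPoint_eq_graphMap hz
  have h := hg.isClosestPoint_closestPoint hz
  rw [h1] at h
  have h2 := hg.inner_sub_graphMap_eq_zero (hg.norm_fst_closestPoint_lt hz) h a
  rwa [← h1] at h2

theorem closestPoint_normalMap (hg : IsSmallGraph g δ) {w : WithLp 2 (X × Y)}
    (h₁ : ‖w.fst‖ < 2) (h₂ : ‖w.snd‖ < 2) (hw : normalMap g w ∈ largeSlab X Y) :
    closestPoint (graphOver g) (normalMap g w) = graphMap g w.fst :=
  hg.eq_graphMap_of_normalMap_eq (hg.isClosestPoint_closestPoint hw) h₁ h₂ rfl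

/-- The closest-point projection onto a flat graph is smooth. -/
theorem contDiffAt_closestPoint (hg : IsSmallGraph g δ) {z : WithLp 2 (X × Y)}
    (hz : z ∈ largeSlab X Y) : ContDiffAt ℝ ∞ (closestPoint (graphOver g)) z := by
  set q := closestPoint (graphOver g) z
  have hq : IsClosestPoint (graphOver g) z q := hg.isClosestPoint_closestPoint hz
  obtain ⟨h1, h2⟩ := mem_graphOver_iff.mp hq.1
  set w : WithLp 2 (X × Y) := WithLp.toLp 2 (q.fst, z.snd - g q.fst)
  have hw1 : ‖w.fst‖ < 2 := h1
  have hw2 : ‖w.snd‖ < 2 := (hg.norm_of_isClosestPoint hz hq).2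
  have hwz : normalMap g w = z := hg.normalMap_of_isClosestPoint h1 (h2 ▸ hq)
  obtain ⟨A, hA⟩ := hg.exists_equiv_hasFDerivAt_normalMap hw1 hw2
  have hne : (∞ : WithTop ℕ∞) ≠ 0 := by simp
  have hsm := hg.contDiffAt_normalMap hw1
  set Ξ := hsm.localInverse hA hne
  have hΞ : ContDiffAt ℝ ∞ Ξ z := hwz ▸ hsm.to_localInverse hA hne
  have hΞz : Ξ z = w := by
    have := hsm.localInverse_apply_image hA hne
    rwa [hwz] at this
  have hright : ∀ᶠ y in 𝓝 z, normalMap g (Ξ y) = y := by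
    have := (hsm.hasStrictFDerivAt' hA hne).eventually_right_inverse
    rwa [hwz] at this
  -- For y near z the preimage Ξ y stays in the region where `normalMap` is injective, so its base
  -- point is that of the closest point.
  have hev : closestPoint (graphOver g) =ᶠ[𝓝 z] fun y => graphMap g (Ξ y).fst := by
    have c1 : ∀ᶠ y in 𝓝 z, ‖(Ξ y).fst‖ < 2 := by
      refine ((WithLp.prod_continuous_fst.continuousAt.comp
        hΞ.continuousAt).norm).eventually_lt continuousAt_const ?_
      simpa [hΞz] using hw1
    have c2 : ∀ᶠ y in 𝓝 z, ‖(Ξ y).snd‖ < 2 := by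
      refine ((WithLp.prod_continuous_snd.continuousAt.comp
        hΞ.continuousAt).norm).eventually_lt continuousAt_const ?_
      simpa [hΞz] using hw2
    filter_upwards [c1, c2, hright, isOpen_largeSlab.mem_nhds hz] with y y1 y2 y3 y4
    have := hg.closestPoint_normalMap y1 y2 (by rwa [y3])
    rwa [y3] at this
  refine ContDiffAt.congr_of_eventuallyEq ?_ hev
  refine ContDiffAt.comp z (g := graphMap g) ?_
    (WithLp.prod_contDiff_fst.contDiffAt.comp z hΞ)
  refine contDiffAt_graphMap (hg.contDiffAt ?_)
  rw [hΞz]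
  exact hw1

end IsSmallGraph

end ClosestPoint

/-! ### The distance from a flat graph -/

section Distance

variable {X Y : Type*} [NormedAddCommGroup X] [InnerProductSpace ℝ X] [FiniteDimensional ℝ X]
  [NormedAddCommGroup Y] [InnerProductSpace ℝ Y] [FiniteDimensional ℝ Y]

namespace IsSmallGraph

variable {g : X → Y} {δ : ℝ} {z : WithLp 2 (X × Y)} {x : X}

theorem hasFDerivAt_graphDeriv_apply (hg : IsSmallGraph g δ) (hx : ‖x‖ < 2) (b : X) :
    HasFDerivAt (fun x => graphDeriv g x b)
      (verticalInclusion X Y ∘L (ContinuousLinearMap.apply ℝ Y b) ∘L fderiv ℝ (fderiv ℝ g) x) x := by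
  have h1 : HasFDerivAt (fderiv ℝ g) (fderiv ℝ (fderiv ℝ g) x) x :=
    ((hg.contDiffAt_fderiv hx).differentiableAt (by simp)).hasFDerivAt
  have h2 := (verticalInclusion X Y).hasFDerivAt.comp x
    ((ContinuousLinearMap.apply ℝ Y b).hasFDerivAt.comp x h1)
  have h3 := h2.const_add (WithLp.toLp 2 (b, (0 : Y)))
  refine h3.congr_of_eventuallyEq (Eventually.of_forall fun y => WithLp.prod_ext ?_ ?_)
  · change b = b + 0
    simp
  · change fderiv ℝ g y b = 0 + fderiv ℝ g y b
    simp

theorem hasFDerivAt_closestPoint (hg : IsSmallGraph g δ) (hz : z ∈ largeSlab X Y) :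
    HasFDerivAt (closestPoint (graphOver g)) (fderiv ℝ (closestPoint (graphOver g)) z) z :=
  ((hg.contDiffAt_closestPoint hz).differentiableAt (by simp)).hasFDerivAt

theorem fderiv_closestPoint_eq (hg : IsSmallGraph g δ) (hz : z ∈ largeSlab X Y)
    (h : WithLp 2 (X × Y)) :
    fderiv ℝ (closestPoint (graphOver g)) z h =
      graphDeriv g (closestPoint (graphOver g) z).fst
        (fderiv ℝ (closestPoint (graphOver g)) z h).fst := by
  have hp := hg.hasFDerivAt_closestPoint hz
  have hF := hasFDerivAt_graphMap (hg.differentiableAt (hg.norm_fst_closestPoint_lt hz))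
  have h1 := hF.comp z hp.prod_fst
  have h2 : closestPoint (graphOver g) =ᶠ[𝓝 z]
      graphMap g ∘ fun w => (closestPoint (graphOver g) w).fst := by
    filter_upwards [isOpen_largeSlab.mem_nhds hz] with w hw
    exact hg.closestPoint_eq_graphMap hw
  have h3 := hp.unique (h1.congr_of_eventuallyEq h2)
  exact congrArg (fun A : WithLp 2 (X × Y) →L[ℝ] WithLp 2 (X × Y) => A h) h3

/-- The derivative at z, in direction h, of the orthogonality relation between w - p(w) and tangent
vectors at p(w), which holds on a whole neighbourhood. This is the source of the equation for Dp. -/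
theorem inner_sub_fderiv_closestPoint (hg : IsSmallGraph g δ) (hz : z ∈ largeSlab X Y)
    (h : WithLp 2 (X × Y)) (b : X) :
    inner ℝ (h - fderiv ℝ (closestPoint (graphOver g)) z h)
        (graphDeriv g (closestPoint (graphOver g) z).fst b)
      + inner ℝ (z - closestPoint (graphOver g) z) (verticalInclusion X Y
        (fderiv ℝ (fderiv ℝ g) (closestPoint (graphOver g) z).fst
          (fderiv ℝ (closestPoint (graphOver g)) z h).fst b)) = 0 := by
  have hp := hg.hasFDerivAt_closestPoint hz
  have h1 := (hg.hasFDerivAt_graphDeriv_apply (hg.norm_fst_closestPoint_lt hz) b).comp z hp.prod_fst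
  have h2 := ((hasFDerivAt_id z).sub hp).inner ℝ h1
  have h3 : HasFDerivAt (fun w => inner ℝ (w - closestPoint (graphOver g) w)
      (graphDeriv g (closestPoint (graphOver g) w).fst b))
      (0 : WithLp 2 (X × Y) →L[ℝ] ℝ) z := by
    refine (hasFDerivAt_const (0 : ℝ) z).congr_of_eventuallyEq ?_
    filter_upwards [isOpen_largeSlab.mem_nhds hz] with w hw
    exact hg.inner_sub_closestPoint_eq_zero hw b
  have h4 := congrArg (fun A : WithLp 2 (X × Y) →L[ℝ] ℝ => A h) (h2.unique h3)
  rw [add_comm]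
  exact h4

theorem tangentPlane_eq (hg : IsSmallGraph g δ) (hx : ‖x‖ < 2) :
    tangentPlane (graphOver g) (graphMap g x) = LinearMap.range (graphDeriv g x).toLinearMap :=
  tangentPlane_graph hx (hg.differentiableAt hx)

theorem tangentPlane_closestPoint (hg : IsSmallGraph g δ) (hz : z ∈ largeSlab X Y) :
    tangentPlane (graphOver g) (closestPoint (graphOver g) z) =
      LinearMap.range (graphDeriv g (closestPoint (graphOver g) z).fst).toLinearMap := by
  conv_lhs => rw [hg.closestPoint_eq_graphMap hz]
  exact hg.tangentPlane_eq (hg.norm_fst_closestPoint_lt hz)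

theorem sub_closestPoint_mem_orthogonal (hg : IsSmallGraph g δ) (hz : z ∈ largeSlab X Y) :
    z - closestPoint (graphOver g) z ∈
      (tangentPlane (graphOver g) (closestPoint (graphOver g) z))ᗮ := by
  rw [hg.tangentPlane_closestPoint hz]
  rintro _ ⟨a, rfl⟩
  rw [real_inner_comm]
  exact hg.inner_sub_closestPoint_eq_zero hz a

theorem infDist_sq_eventuallyEq (hg : IsSmallGraph g δ) (hz : z ∈ largeSlab X Y) :
    (fun w => Metric.infDist w (graphOver g) ^ 2 / 2) =ᶠ[𝓝 z]
      fun w => ‖w - closestPoint (graphOver g) w‖ ^ 2 / 2 := by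
  filter_upwards [isOpen_largeSlab.mem_nhds hz] with w hw
  rw [hg.infDist_eq_norm hw]

theorem contDiffAt_infDist_sq (hg : IsSmallGraph g δ) (hz : z ∈ largeSlab X Y) :
    ContDiffAt ℝ ∞ (fun w => Metric.infDist w (graphOver g) ^ 2 / 2) z := by
  refine ContDiffAt.congr_of_eventuallyEq ?_ (hg.infDist_sq_eventuallyEq hz)
  exact ((contDiffAt_id.sub (hg.contDiffAt_closestPoint hz)).norm_sq ℝ).div_const 2

/-- The derivative of p takes tangential values, orthogonal to z - p(z), so it contributes nothing
to the derivative of |z - p(z)|²/2. -/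
theorem hasGradientAt_infDist_sq (hg : IsSmallGraph g δ) (hz : z ∈ largeSlab X Y) :
    HasGradientAt (fun w => Metric.infDist w (graphOver g) ^ 2 / 2)
      (z - closestPoint (graphOver g) z) z := by
  rw [hasGradientAt_iff_hasFDerivAt]
  have h1 := (((hasFDerivAt_id z).sub (hg.hasFDerivAt_closestPoint hz)).norm_sq).const_mul (2 : ℝ)⁻¹
  have h2 := h1.congr_of_eventuallyEq ((hg.infDist_sq_eventuallyEq hz).trans
    (Eventually.of_forall fun w => div_eq_inv_mul _ _))
  refine h2.congr_fderiv ?_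
  ext1 h
  have h3 : inner ℝ (z - closestPoint (graphOver g) z)
      (fderiv ℝ (closestPoint (graphOver g)) z h) = 0 := by
    rw [hg.fderiv_closestPoint_eq hz]
    exact hg.inner_sub_closestPoint_eq_zero hz _
  change (2 : ℝ)⁻¹ * (2 • inner ℝ (z - closestPoint (graphOver g) z)
    (h - fderiv ℝ (closestPoint (graphOver g)) z h)) = inner ℝ (z - closestPoint (graphOver g) z) h
  rw [inner_sub_right, h3, sub_zero, nsmul_eq_mul]
  push_cast
  ring

theorem gradient_infDist_sq_eventuallyEq (hg : IsSmallGraph g δ) (hz : z ∈ largeSlab X Y) :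
    gradient (fun w => Metric.infDist w (graphOver g) ^ 2 / 2) =ᶠ[𝓝 z]
      fun w => w - closestPoint (graphOver g) w := by
  filter_upwards [isOpen_largeSlab.mem_nhds hz] with w hw
  exact (hg.hasGradientAt_infDist_sq hw).gradient

theorem laplacianAlong_infDist_sq (hg : IsSmallGraph g δ) (hz : z ∈ largeSlab X Y)
    (T : Submodule ℝ (WithLp 2 (X × Y))) :
    laplacianAlong T (fun w => Metric.infDist w (graphOver g) ^ 2 / 2) z =
      clmTrace (T.starProjection * (1 - fderiv ℝ (closestPoint (graphOver g)) z)) := by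
  have h1 := ((hasFDerivAt_id z).sub (hg.hasFDerivAt_closestPoint hz)).congr_of_eventuallyEq
    (hg.gradient_infDist_sq_eventuallyEq hz)
  rw [laplacianAlong, divAlong, h1.fderiv]
  rfl

/-! ### The second fundamental form of the graph -/

theorem graphMap_mem_largeSlab (hg : IsSmallGraph g δ) (hx : ‖x‖ < 3 / 2) :
    graphMap g x ∈ largeSlab X Y :=
  ⟨hx, by
    rw [graphMap_snd]
    linarith [hg.norm_le x (by linarith), hg.le]⟩

theorem closestPoint_graphMap (hg : IsSmallGraph g δ) (hx : ‖x‖ < 3 / 2) :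
    closestPoint (graphOver g) (graphMap g x) = graphMap g x := by
  have h1 := (hg.isClosestPoint_closestPoint (hg.graphMap_mem_largeSlab hx)).2
  have hmem : graphMap g x ∈ graphOver g := ⟨by rw [graphMap_fst]; linarith, rfl⟩
  rw [Metric.infDist_zero_of_mem hmem] at h1
  exact (dist_eq_zero.mp h1).symm

/-- On M the curvature term of the differentiated orthogonality relation has the factor z - p(z) =
0, so h - Dp h is normal while Dp h is tangent. Thus Dp is a smooth ambient extension of the field
of tangent projections. -/
theorem fderiv_closestPoint_graphMap (hg : IsSmallGraph g δ) (hx : ‖x‖ < 3 / 2) :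
    fderiv ℝ (closestPoint (graphOver g)) (graphMap g x) =
      (tangentPlane (graphOver g) (graphMap g x)).starProjection := by
  have hz := hg.graphMap_mem_largeSlab hx
  have hp := hg.closestPoint_graphMap hx
  rw [hg.tangentPlane_eq (by linarith)]
  ext1 h
  refine (Submodule.eq_starProjection_of_mem_of_inner_eq_zero ?_ ?_).symm
  · have h1 := hg.fderiv_closestPoint_eq hz h
    rw [hp] at h1
    exact ⟨_, h1.symm⟩
  · rintro _ ⟨b, rfl⟩
    have h1 := hg.inner_sub_fderiv_closestPoint hz h b
    rw [hp, sub_self, inner_zero_left, add_zero] at h1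
    exact h1

/-- The second fundamental form of a graph is the normal part of `(0, D²g)`. -/
theorem secondFundamentalForm_eq (hg : IsSmallGraph g δ) (hx : ‖x‖ < 3 / 2) (a b : X) :
    secondFundamentalForm (graphOver g) (graphMap g x) (graphDeriv g x a) (graphDeriv g x b) =
      (tangentPlane (graphOver g) (graphMap g x))ᗮ.starProjection
        (verticalInclusion X Y (fderiv ℝ (fderiv ℝ g) x a b)) := by
  have hx2 : ‖x‖ < 2 := by linarith
  have hz := hg.graphMap_mem_largeSlab hx
  set q := graphMap g x with hq
  set p := closestPoint (graphOver g)
  set u := graphDeriv g x a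
  set v := graphDeriv g x b
  have hD2 : HasFDerivAt (fderiv ℝ p) (fderiv ℝ (fderiv ℝ p) q) q :=
    (((hg.contDiffAt_closestPoint hz).fderiv_right (m := ∞) (by simp)).differentiableAt
      (by simp)).hasFDerivAt
  have hN : HasFDerivWithinAt (fun w => (tangentPlane (graphOver g) w).starProjection v)
      ((ContinuousLinearMap.apply ℝ _ v) ∘L fderiv ℝ (fderiv ℝ p) q) (graphOver g) q := by
    have h1 := ((ContinuousLinearMap.apply ℝ (WithLp 2 (X × Y)) v).hasFDerivAt.comp q
      hD2).hasFDerivWithinAt (s := graphOver g)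
    refine h1.congr_of_eventuallyEq ?_ ?_
    · filter_upwards [self_mem_nhdsWithin,
        mem_nhdsWithin_of_mem_nhds (isOpen_largeSlab.mem_nhds hz)] with w hw hws
      obtain ⟨hw1, hw2⟩ := mem_graphOver_iff.mp hw
      have h2 := hg.fderiv_closestPoint_graphMap hws.1
      rw [← hw2] at h2
      change _ = fderiv ℝ p w v
      rw [h2]
    · change _ = fderiv ℝ p q v
      rw [hg.fderiv_closestPoint_graphMap hx]
  have hu : u ∈ tangentPlane (graphOver g) q := by
    rw [hg.tangentPlane_eq hx2]
    exact ⟨a, rfl⟩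
  -- Derivatives within M agree on the tangent cone, hence on its span, so the chosen one may be
  -- computed from the extension Dp.
  have hW : fderivWithin ℝ (fun w => (tangentPlane (graphOver g) w).starProjection v)
      (graphOver g) q u = fderiv ℝ (fderiv ℝ p) q u v := by
    have h1 := hN.differentiableWithinAt.hasFDerivWithinAt.unique_on hN
    exact LinearMap.eqOn_span (f := (fderivWithin ℝ (fun w => (tangentPlane (graphOver g)
      w).starProjection v) (graphOver g) q).toLinearMap)
      (g := ((ContinuousLinearMap.apply ℝ _ v) ∘L fderiv ℝ (fderiv ℝ p) q).toLinearMap) h1 hu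
  -- The identity Dp(F(y)) DF(y)b = DF(y)b is differentiated at x in direction a.
  have hsum : fderiv ℝ (fderiv ℝ p) q u v + fderiv ℝ p q
      (verticalInclusion X Y (fderiv ℝ (fderiv ℝ g) x a b)) =
      verticalInclusion X Y (fderiv ℝ (fderiv ℝ g) x a b) := by
    have hF := hasFDerivAt_graphMap (hg.differentiableAt hx2)
    have hJ := hg.hasFDerivAt_graphDeriv_apply hx2 b
    have h1 := (HasFDerivAt.comp (g := fderiv ℝ p) x hD2 hF).clm_apply hJ
    have h2 : (fun y => graphDeriv g y b) =ᶠ[𝓝 x]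
        fun y => (fderiv ℝ p ∘ graphMap g) y (graphDeriv g y b) := by
      filter_upwards [Metric.isOpen_ball.mem_nhds
        (show x ∈ Metric.ball (0 : X) (3 / 2) by simpa using hx)] with y hy
      have hy' : ‖y‖ < 3 / 2 := by simpa using hy
      rw [Function.comp_apply, hg.fderiv_closestPoint_graphMap hy',
        hg.tangentPlane_eq (by linarith)]
      have hb : graphDeriv g y b ∈ LinearMap.range (graphDeriv g y).toLinearMap := ⟨b, rfl⟩
      exact (Submodule.starProjection_eq_self_iff.mpr hb).symm
    have h3 := congrArg (fun A : X →L[ℝ] WithLp 2 (X × Y) => A a)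
      ((h1.congr_of_eventuallyEq h2).unique hJ)
    rw [add_comm]
    exact h3
  rw [secondFundamentalForm, hW]
  rw [hg.fderiv_closestPoint_graphMap hx] at hsum
  rw [eq_sub_of_add_eq hsum]
  rw [map_sub, sub_eq_self]
  refine (Submodule.starProjection_apply_eq_zero_iff _).mpr ?_
  rw [Submodule.orthogonal_orthogonal]
  exact Submodule.starProjection_apply_mem _ _

theorem norm_secondFundamentalForm_le (hg : IsSmallGraph g δ) (hx : ‖x‖ < 3 / 2)
    {u v : WithLp 2 (X × Y)} (hu : u ∈ tangentPlane (graphOver g) (graphMap g x))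
    (hv : v ∈ tangentPlane (graphOver g) (graphMap g x)) :
    ‖secondFundamentalForm (graphOver g) (graphMap g x) u v‖ ≤ δ / 2 * ‖u‖ * ‖v‖ := by
  have hx2 : ‖x‖ < 2 := by linarith
  rw [hg.tangentPlane_eq hx2] at hu hv
  obtain ⟨a, rfl⟩ := hu
  obtain ⟨b, rfl⟩ := hv
  have ha : ‖a‖ ≤ ‖graphDeriv g x a‖ := WithLp.prod_norm_fst_le (graphDeriv g x a)
  have hb : ‖b‖ ≤ ‖graphDeriv g x b‖ := WithLp.prod_norm_fst_le (graphDeriv g x b)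
  have hδ := hg.nonneg
  change ‖secondFundamentalForm (graphOver g) (graphMap g x) (graphDeriv g x a)
    (graphDeriv g x b)‖ ≤ δ / 2 * ‖graphDeriv g x a‖ * ‖graphDeriv g x b‖
  rw [hg.secondFundamentalForm_eq hx]
  refine (Submodule.norm_starProjection_apply_le _ _).trans ?_
  have h1 : ‖verticalInclusion X Y (fderiv ℝ (fderiv ℝ g) x a b)‖ ≤
      ‖fderiv ℝ (fderiv ℝ g) x a b‖ := by
    refine (WithLp.prod_norm_le_add _).trans ?_
    rw [verticalInclusion_fst, verticalInclusion_snd, norm_zero, zero_add]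
  refine h1.trans ((ContinuousLinearMap.le_opNorm₂ _ _ _).trans ?_)
  have h2 := hg.norm_fderiv_fderiv_le x hx2
  gcongr

theorem secondFundamentalFormNorm_le (hg : IsSmallGraph g δ) (hx : ‖x‖ < 3 / 2) :
    secondFundamentalFormNorm (graphOver g) (graphMap g x) ≤ Module.finrank ℝ X * (δ / 2) := by
  have hδ := hg.nonneg
  have hfin : Module.finrank ℝ (tangentPlane (graphOver g) (graphMap g x)) =
      Module.finrank ℝ X := by
    rw [hg.tangentPlane_eq (by linarith), finrank_range_graphDeriv]
  refine Real.sqrt_le_iff.mpr ⟨by positivity, ?_⟩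
  set s := stdOrthonormalBasis ℝ (tangentPlane (graphOver g) (graphMap g x))
  have h1 : ∀ i j, ‖secondFundamentalForm (graphOver g) (graphMap g x) (s i) (s j)‖ ^ 2 ≤
      (δ / 2) ^ 2 := by
    intro i j
    have h2 := hg.norm_secondFundamentalForm_le hx (s i).2 (s j).2
    have h3 : ∀ i, ‖(s i : WithLp 2 (X × Y))‖ = 1 := fun i => s.norm_eq_one i
    rw [h3, h3, mul_one, mul_one] at h2
    gcongr
  calc _ ≤ ∑ i : Fin (Module.finrank ℝ (tangentPlane (graphOver g) (graphMap g x))),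
        ∑ j : Fin (Module.finrank ℝ (tangentPlane (graphOver g) (graphMap g x))), (δ / 2) ^ 2 :=
        Finset.sum_le_sum fun i _ => Finset.sum_le_sum fun j _ => h1 i j
    _ = _ := by
      simp only [Finset.sum_const, Finset.card_univ, Fintype.card_fin, hfin, nsmul_eq_mul]
      ring

theorem norm_fst_closestPoint_lt_of_norm_fst_lt (hg : IsSmallGraph g δ)
    (hz : z ∈ largeSlab X Y) (hz1 : ‖z.fst‖ < 1) :
    ‖(closestPoint (graphOver g) z).fst‖ < 3 / 2 := by
  have h1 := (hg.norm_of_isClosestPoint hz (hg.isClosestPoint_closestPoint hz)).1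
  have h2 := norm_add_le ((closestPoint (graphOver g) z).fst - z.fst) z.fst
  rw [sub_add_cancel] at h2
  linarith [hg.le]

/-- The Laplacian of half the squared distance along a plane. -/
theorem laplacianAlong_infDist_sq_ge (hg : IsSmallGraph g δ)
    (hδ : Module.finrank ℝ X * δ ≤ 1 / 2)
    (hz : z ∈ largeSlab X Y) (hz1 : ‖z.fst‖ < 1) {T : Submodule ℝ (WithLp 2 (X × Y))}
    (hT : Module.finrank ℝ T = Module.finrank ℝ X) :
    planeDistSq T (tangentPlane (graphOver g) (closestPoint (graphOver g) z)) / 4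
        - ‖meanCurvature (graphOver g) (closestPoint (graphOver g) z)‖ *
          Metric.infDist z (graphOver g)
        - 2 * secondFundamentalFormNorm (graphOver g) (closestPoint (graphOver g) z) *
          Metric.infDist z (graphOver g) ^ 2 ≤
      laplacianAlong T (fun w => Metric.infDist w (graphOver g) ^ 2 / 2) z := by
  rw [hg.laplacianAlong_infDist_sq hz, hg.infDist_eq_norm hz]
  have hd2 := hg.infDist_le_two hz
  rw [hg.infDist_eq_norm hz] at hd2
  set q := closestPoint (graphOver g) z with hqdef
  set x := q.fst with hxdef
  have hx : ‖x‖ < 3 / 2 := hg.norm_fst_closestPoint_lt_of_norm_fst_lt hz hz1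
  have hx2 : ‖x‖ < 2 := by linarith
  have hq : q = graphMap g x := hg.closestPoint_eq_graphMap hz
  set S := tangentPlane (graphOver g) q with hSdef
  have hS : S = LinearMap.range (graphDeriv g x).toLinearMap := hg.tangentPlane_closestPoint hz
  set L := fderiv ℝ (closestPoint (graphOver g)) z with hLdef
  set ν := z - q
  have hν : ν ∈ Sᗮ := hg.sub_closestPoint_mem_orthogonal hz
  set D2 := fderiv ℝ (fderiv ℝ g) x
  have hsymm : ∀ a b, D2 a b = D2 b a := fun a b =>
    ((hg.contDiffAt hx2).isSymmSndFDerivAt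
      (by rw [minSmoothness_of_isRCLikeNormedField]; exact WithTop.coe_le_coe.mpr le_top)).eq a b
  -- the shape operator in the direction `ν`
  let G : X →L[ℝ] X := (ContinuousLinearMap.apply ℝ X ν.snd) ∘L (adjointCLM X Y) ∘L D2
  have hG : ∀ a b, inner ℝ (G a) b = inner ℝ (D2 a b) ν.snd := fun a b => by
    rw [real_inner_comm]
    exact inner_adjointCLM (D2 a) b ν.snd
  let ι : X →L[ℝ] WithLp 2 (X × Y) :=
    ((WithLp.prodContinuousLinearEquiv 2 ℝ X Y).symm : X × Y →L[ℝ] WithLp 2 (X × Y)) ∘L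
      ContinuousLinearMap.inl ℝ X Y
  have hι : ∀ a w, inner ℝ (ι a) w = inner ℝ a w.fst := fun a w => by
    rw [WithLp.prod_inner_eq]
    change inner ℝ a w.fst + inner ℝ (0 : Y) w.snd = _
    simp
  -- Projecting to S on both sides extends the shape operator by zero to the normal space and makes
  -- it symmetric in the ambient inner product.
  let B : WithLp 2 (X × Y) →L[ℝ] WithLp 2 (X × Y) :=
    S.starProjection ∘L ι ∘L G ∘L (WithLp.fstL 2 ℝ X Y) ∘L S.starProjection
  have hBinner : ∀ h k, inner ℝ (B h) k =
      inner ℝ (D2 (S.starProjection h).fst (S.starProjection k).fst) ν.snd := fun h k => by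
    change inner ℝ (S.starProjection (ι (G (S.starProjection h).fst))) k = _
    rw [Submodule.inner_starProjection_left_eq_right, hι, hG]
  have hBsymm : ∀ h k, inner ℝ (B h) k = inner ℝ h (B k) := fun h k => by
    rw [real_inner_comm (B k), hBinner, hBinner, hsymm]
  have hBS : ∀ h, B h ∈ S := fun h => Submodule.starProjection_apply_mem S _
  have hproj : ∀ s ∈ S, S.starProjection s = s := fun s hs =>
    Submodule.starProjection_eq_self_iff.mpr hs
  have hLS : ∀ h, L h ∈ S := fun h => by
    rw [hS, hLdef, hg.fderiv_closestPoint_eq hz]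
    exact ⟨_, rfl⟩
  have hL : L = S.starProjection + B * L := by
    ext1 h
    change L h = S.starProjection h + B (L h)
    have h0 : S.starProjection h + B (L h) - L h ∈ S :=
      S.sub_mem (S.add_mem (Submodule.starProjection_apply_mem S h) (hBS _)) (hLS h)
    -- Both sides of the equation for L lie in S, so testing against S suffices; there it is the
    -- differentiated orthogonality relation.
    have h1 : ∀ s ∈ S, inner ℝ (S.starProjection h + B (L h) - L h) s = 0 := by
      intro s hs
      obtain ⟨b, rfl⟩ : ∃ b, graphDeriv g x b = s := by
        rw [hS] at hs
        exact hs
      have h2 := hg.inner_sub_fderiv_closestPoint hz h b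
      rw [WithLp.prod_inner_eq (z - _), verticalInclusion_fst, verticalInclusion_snd,
        inner_zero_right, zero_add, inner_sub_left] at h2
      rw [inner_sub_left, inner_add_left, hBinner, hproj _ (hLS h), hproj _ hs,
        Submodule.inner_starProjection_left_eq_right, hproj _ hs, graphDeriv_fst,
        real_inner_comm ν.snd]
      linarith
    have h3 := h1 _ h0
    rw [inner_self_eq_zero] at h3
    exact (sub_eq_zero.mp h3).symm
  have hII : ∀ u ∈ S, ∀ v ∈ S, inner ℝ (B u) v =
      inner ℝ ν (secondFundamentalForm (graphOver g) q u v) := by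
    intro u hu v hv
    rw [hBinner, hproj u hu, hproj v hv]
    rw [hS] at hu hv
    obtain ⟨a, rfl⟩ := hu
    obtain ⟨b, rfl⟩ := hv
    have h1 := hg.secondFundamentalForm_eq hx a b
    rw [← hq] at h1
    change inner ℝ (D2 a b) ν.snd = inner ℝ ν (secondFundamentalForm (graphOver g) q
      (graphDeriv g x a) (graphDeriv g x b))
    rw [h1, ← Submodule.inner_starProjection_left_eq_right,
      Submodule.starProjection_eq_self_iff.mpr hν, WithLp.prod_inner_eq ν, verticalInclusion_fst,
      verticalInclusion_snd, inner_zero_right, zero_add, real_inner_comm]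
  set s := stdOrthonormalBasis ℝ S with hs
  have htr : clmTrace B = inner ℝ ν (meanCurvature (graphOver g) q) := by
    rw [clmTrace_eq_sum_subspace hBsymm hBS s, meanCurvature, inner_sum]
    exact Finset.sum_congr rfl fun i _ => hII _ (s i).2 _ (s i).2
  set κ₀ := secondFundamentalFormNorm (graphOver g) q with hκ₀
  have hκ₀0 : 0 ≤ κ₀ := Real.sqrt_nonneg _
  have hκ₀1 : κ₀ ≤ 1 / 4 := by
    have h1 := hg.secondFundamentalFormNorm_le hx
    rw [← hq] at h1
    linarith
  have hHS : ∑ k, ‖B (stdOrthonormalBasis ℝ (WithLp 2 (X × Y)) k)‖ ^ 2 ≤ (κ₀ * ‖ν‖) ^ 2 := by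
    rw [sum_norm_sq_eq_sum_subspace hBsymm hBS s, mul_pow, hκ₀, secondFundamentalFormNorm,
      Real.sq_sqrt (Finset.sum_nonneg fun _ _ => Finset.sum_nonneg fun _ _ => sq_nonneg _),
      Finset.sum_mul]
    refine Finset.sum_le_sum fun i _ => ?_
    rw [Finset.sum_mul]
    refine Finset.sum_le_sum fun j _ => ?_
    rw [hII _ (s i).2 _ (s j).2, ← mul_pow, ← sq_abs]
    gcongr
    rw [mul_comm]
    exact abs_real_inner_le_norm _ _
  have hST : Module.finrank ℝ S = Module.finrank ℝ T := by
    rw [hS, finrank_range_graphDeriv, hT]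
  -- The smallness condition holds since κ₀ ≤ 1/4 and |ν| ≤ 2. Below, κ₀ ≤ 1 turns κ₀²|ν|² into
  -- κ₀|ν|².
  have hmain := clmTrace_starProjection_mul_one_sub_ge hST hBsymm hBS hL
    (κ := κ₀ * ‖ν‖) (by positivity) (by nlinarith [norm_nonneg ν]) hHS
  have h1 : clmTrace B ≤ ‖meanCurvature (graphOver g) q‖ * ‖ν‖ := by
    rw [htr, mul_comm]
    exact real_inner_le_norm _ _
  have h2 : (κ₀ * ‖ν‖) ^ 2 ≤ κ₀ * ‖ν‖ ^ 2 := by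
    rw [mul_pow]
    gcongr
    nlinarith
  linarith

end IsSmallGraph

end Distance

/-! ### Approximate tangent planes on a differentiable set -/

section ApproxTangent

variable {E : Type*} [NormedAddCommGroup E] [InnerProductSpace ℝ E] [FiniteDimensional ℝ E]
  [MeasurableSpace E] [BorelSpace E]

/-- Through the isometric inclusion the integral becomes one over T, on which Hausdorff measure of
dimension dim T is positive on nonempty open sets. -/
theorem setIntegral_hausdorff_pos {m : ℕ} {T : Submodule ℝ E} (hT : Module.finrank ℝ T = m)
    {φ : E → ℝ} (hφ : Continuous φ) (hc : HasCompactSupport φ) (h0 : ∀ w, 0 ≤ φ w)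
    {v : E} (hv : v ∈ T) (hφv : φ v ≠ 0) :
    0 < ∫ w in (T : Set E), φ w ∂(hausdorff E m) := by
  have hmap : (μH[(m : ℝ)] : Measure E).restrict (T : Set E) =
      (μH[(m : ℝ)] : Measure T).map Subtype.val := by
    have h := (isometry_subtype_coe (s := (T : Set E))).map_hausdorffMeasure
      (d := (m : ℝ)) (Or.inl (Nat.cast_nonneg m))
    rw [Subtype.range_coe] at h
    exact h.symm
  have hcl : IsClosed (T : Set E) := T.closed_of_finiteDimensional
  have hemb : MeasurableEmbedding (Subtype.val : T → E) :=
    MeasurableEmbedding.subtype_coe hcl.measurableSet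
  rw [hausdorff, Measure.restrict_smul, integral_smul_measure, hmap, hemb.integral_map]
  refine smul_pos (ENNReal.toReal_pos ?_ ?_) ?_
  · exact (Metric.measure_ball_pos _ _ (by norm_num)).ne'
  · exact measure_ball_lt_top.ne
  · subst hT
    have hcT : HasCompactSupport (fun t : T => φ t) :=
      hc.comp_isClosedEmbedding hcl.isClosedEmbedding_subtypeVal
    exact (hφ.comp continuous_subtype_val).integral_pos_of_hasCompactSupport_nonneg_nonzero
      hcT (fun t => h0 t) (x := (⟨v, hv⟩ : T)) hφv

theorem integrable_of_support_subset {μ : Measure E} {f : E → ℝ} {s : Set E} {C : ℝ}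
    (hμ : μ s < ⊤) (hf : Measurable f) (hC : ∀ w, ‖f w‖ ≤ C)
    (hfs : ∀ w, w ∉ s → f w = 0) : Integrable f μ := by
  rw [← integrableOn_iff_integrable_of_support_subset (s := s)
    fun w hw => by_contra fun h => hw (hfs w h)]
  exact Measure.integrableOn_of_bounded hμ.ne hf.aestronglyMeasurable (Eventually.of_forall hC)

variable {μ : Measure E} {z : E}

/-- An approximate tangent plane bounds the upper density. -/
theorem IsApproxTangent.exists_measureReal_le {m : ℕ} {θ : ℝ} {T : Submodule ℝ E}
    (h : IsApproxTangent m μ θ z T) {ρ : ℝ} (hρ : 0 < ρ) (hμ : μ (Metric.closedBall z ρ) < ⊤)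
    {R : ℝ} (hR : 0 < R) :
    ∃ C, ∀ᶠ r in 𝓝[>] (0 : ℝ), μ.real (Metric.closedBall z (r * R)) ≤ C * r ^ m := by
  let ψ : E → ℝ := fun w => max 0 (1 + R - ‖w‖)
  have hψ : Continuous ψ := by fun_prop
  have hψ0 : ∀ w, 0 ≤ ψ w := fun w => le_max_left _ _
  have hψ1 : ∀ w, ψ w ≤ 1 + R := fun w => max_le (by positivity) (by linarith [norm_nonneg w])
  have hψs : ∀ w, 1 + R < ‖w‖ → ψ w = 0 := fun w hw => max_eq_left (by linarith)
  have hψc : HasCompactSupport ψ := by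
    refine HasCompactSupport.intro (isCompact_closedBall 0 (1 + R)) fun w hw => hψs w ?_
    simpa using hw
  have hlim := h ψ hψ hψc
  set ℓ := θ * ∫ w in (T : Set E), ψ w ∂(hausdorff E m)
  refine ⟨ℓ + 1, ?_⟩
  have hsmall : ∀ᶠ r in 𝓝[>] (0 : ℝ), r * (1 + R) < ρ := by
    have : Tendsto (fun r : ℝ => r * (1 + R)) (𝓝[>] 0) (𝓝 (0 * (1 + R))) :=
      (tendsto_id.mul_const _).mono_left nhdsWithin_le_nhds
    rw [zero_mul] at this
    exact this.eventually_lt_const hρ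
  filter_upwards [hlim.eventually_lt_const (lt_add_one ℓ), hsmall, self_mem_nhdsWithin]
    with r h1 h2 hr
  have hr0 : (0 : ℝ) < r := hr
  have hint : Integrable (fun w => ψ (r⁻¹ • (w - z))) μ := by
    refine integrable_of_support_subset (C := 1 + R) hμ
      (by fun_prop) (fun w => ?_) fun w hw => hψs _ ?_
    · rw [Real.norm_of_nonneg (hψ0 _)]
      exact hψ1 _
    · rw [Metric.mem_closedBall, not_le, dist_eq_norm] at hw
      rw [norm_smul, norm_inv, Real.norm_of_nonneg hr0.le, lt_inv_mul_iff₀ hr0]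
      linarith
  have hle : μ.real (Metric.closedBall z (r * R)) ≤ ∫ w, ψ (r⁻¹ • (w - z)) ∂μ := by
    have hm : MeasurableSet (Metric.closedBall z (r * R)) :=
      Metric.isClosed_closedBall.measurableSet
    rw [← integral_indicator_one hm]
    refine integral_mono_of_nonneg (Eventually.of_forall fun w => ?_) hint
      (Eventually.of_forall fun w => ?_)
    · exact indicator_nonneg (fun _ _ => zero_le_one) w
    · by_cases hw : w ∈ Metric.closedBall z (r * R)
      swap
      · rw [indicator_of_notMem hw]
        exact hψ0 _
      rw [indicator_of_mem hw]
      rw [Metric.mem_closedBall, dist_eq_norm] at hw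
      refine le_max_of_le_right ?_
      have : ‖r⁻¹ • (w - z)‖ ≤ R := by
        rw [norm_smul, norm_inv, Real.norm_of_nonneg hr0.le, inv_mul_le_iff₀ hr0]
        exact hw
      simp only [Pi.one_apply]
      linarith
  refine hle.trans ?_
  rw [inv_mul_lt_iff₀ (by positivity)] at h1
  linarith

/-- If `z` is a density point of `M`, and `M` is differentiable at `z` with tangent plane `T'`, then
approximate tangent planes at `z` are contained in `T'`. -/
theorem IsApproxTangent.le_of_density {m : ℕ} {θ : ℝ} {T T' : Submodule ℝ E} {M : Set E}
    (h : IsApproxTangent m μ θ z T) (hθ : 0 < θ) (hT : Module.finrank ℝ T = m)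
    {ρ : ℝ} (hρ : 0 < ρ) (hμ : μ (Metric.closedBall z ρ) < ⊤) (hM : MeasurableSet M)
    (hdens : Tendsto (fun r => μ (Mᶜ ∩ Metric.closedBall z r) / μ (Metric.closedBall z r))
      (𝓝[>] 0) (𝓝 0))
    (hdiff : ∀ ε > 0, ∀ᶠ w in 𝓝 z, w ∈ M → ‖T'ᗮ.starProjection (w - z)‖ ≤ ε * ‖w - z‖) :
    T ≤ T' := by
  intro v hv
  by_contra hvT'
  set N := T'ᗮ.starProjection
  have hc : 0 < ‖N v‖ := by
    rw [norm_pos_iff]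
    intro h0
    rw [Submodule.starProjection_apply_eq_zero_iff, Submodule.orthogonal_orthogonal] at h0
    exact hvT' h0
  set c := ‖N v‖
  set R := ‖v‖ + c
  have hR : 0 < R := by positivity
  -- A bump around v whose support has normal component at least c/2. Rescaled points of M have
  -- normal component at most c/4, so φ only sees the complement of M, whose density at z is zero;
  -- yet its limit integral over T is positive.
  let φ : E → ℝ := fun w => max 0 (c / 2 - ‖w - v‖)
  have hφ : Continuous φ := by fun_prop
  have hφ0 : ∀ w, 0 ≤ φ w := fun w => le_max_left _ _
  have hφ1 : ∀ w, φ w ≤ c / 2 := fun w => max_le (by positivity) (by linarith [norm_nonneg (w - v)])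
  have hφs : ∀ w, φ w ≠ 0 → ‖w - v‖ < c / 2 := fun w hw => by
    by_contra! hlt
    exact hw (max_eq_left (by linarith))
  have hφR : ∀ w, φ w ≠ 0 → ‖w‖ ≤ R := fun w hw => by
    have := norm_add_le (w - v) v
    rw [sub_add_cancel] at this
    linarith [hφs w hw]
  have hφc : HasCompactSupport φ := by
    refine HasCompactSupport.intro (isCompact_closedBall 0 R) fun w hw => ?_
    by_contra hne
    exact hw (by simpa using hφR w hne)
  have hφv : φ v ≠ 0 := by
    simp only [φ, sub_self, norm_zero, sub_zero]
    rw [max_eq_right (by positivity)]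
    positivity
  have hpos : 0 < θ * ∫ w in (T : Set E), φ w ∂(hausdorff E m) :=
    mul_pos hθ (setIntegral_hausdorff_pos hT hφ hφc hφ0 hv hφv)
  have hlim := h φ hφ hφc
  obtain ⟨C, hC⟩ := h.exists_measureReal_le hρ hμ hR
  have hmulR : Tendsto (fun r : ℝ => r * R) (𝓝[>] 0) (𝓝[>] 0) := by
    refine tendsto_nhdsWithin_iff.mpr ⟨?_, ?_⟩
    · have : Tendsto (fun r : ℝ => r * R) (𝓝[>] 0) (𝓝 (0 * R)) :=
        (tendsto_id.mul_const _).mono_left nhdsWithin_le_nhds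
      rwa [zero_mul] at this
    · filter_upwards [self_mem_nhdsWithin] with r hr
      exact mul_pos hr hR
  let ratio : ℝ → ℝ := fun r =>
    (μ (Mᶜ ∩ Metric.closedBall z (r * R)) / μ (Metric.closedBall z (r * R))).toReal
  have hratio : Tendsto ratio (𝓝[>] 0) (𝓝 0) := by
    have := (ENNReal.tendsto_toReal ENNReal.zero_ne_top).comp (hdens.comp hmulR)
    rwa [ENNReal.toReal_zero] at this
  obtain ⟨ρ', hρ', hball⟩ := Metric.eventually_nhds_iff.mp (hdiff (c / (4 * R)) (by positivity))
  have hbound : ∀ᶠ r in 𝓝[>] (0 : ℝ),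
      (r ^ m)⁻¹ * ∫ w, φ (r⁻¹ • (w - z)) ∂μ ≤ c / 2 * (C * ratio r) := by
    have hlt : ∀ ρ > 0, ∀ᶠ r in 𝓝[>] (0 : ℝ), r * R < ρ := fun ρ hρ =>
      (tendsto_nhdsWithin_iff.mp hmulR).1.eventually_lt_const hρ
    filter_upwards [hC, hlt ρ hρ, hlt ρ' hρ', self_mem_nhdsWithin] with r h1 h2 h3 hr
    have hr0 : (0 : ℝ) < r := hr
    have hfin : μ (Metric.closedBall z (r * R)) < ⊤ :=
      (measure_mono (Metric.closedBall_subset_closedBall h2.le)).trans_lt hμ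
    set A := Mᶜ ∩ Metric.closedBall z (r * R) with hA
    have hAm : MeasurableSet A := hM.compl.inter Metric.isClosed_closedBall.measurableSet
    have hAfin : μ A < ⊤ := (measure_mono inter_subset_right).trans_lt hfin
    have hmem : ∀ w, φ (r⁻¹ • (w - z)) ≠ 0 → w ∈ A := by
      intro w hw
      set u := r⁻¹ • (w - z)
      have hwu : w - z = r • u := by rw [smul_inv_smul₀ hr0.ne']
      have hwn : ‖w - z‖ = r * ‖u‖ := by rw [hwu, norm_smul, Real.norm_of_nonneg hr0.le]
      have huR := hφR u hw
      have hwR : ‖w - z‖ ≤ r * R := by rw [hwn]; gcongr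
      refine ⟨fun hwM => ?_, by rwa [Metric.mem_closedBall, dist_eq_norm]⟩
      have h5 := hball (y := w) (by rw [dist_eq_norm]; linarith) hwM
      rw [hwn, hwu, map_smul, norm_smul, Real.norm_of_nonneg hr0.le] at h5
      have h6 : ‖N u‖ ≤ c / (4 * R) * ‖u‖ := by
        refine le_of_mul_le_mul_left ?_ hr0
        linarith
      have h7 : c / (4 * R) * ‖u‖ ≤ c / 4 := by
        calc c / (4 * R) * ‖u‖ ≤ c / (4 * R) * R := by gcongr
          _ = c / 4 := by field_simp
      have h8 : c ≤ ‖N u‖ + ‖u - v‖ := by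
        have h9 : N v = N u - N (u - v) := by rw [map_sub]; abel
        have h10 : ‖N (u - v)‖ ≤ ‖u - v‖ := Submodule.norm_starProjection_apply_le _ _
        have h11 := norm_sub_le (N u) (N (u - v))
        rw [← h9] at h11
        linarith
      linarith [hφs u hw]
    have hint : ∫ w, φ (r⁻¹ • (w - z)) ∂μ ≤ c / 2 * μ.real A := by
      have hind : ∫ w, A.indicator (fun _ => c / 2) w ∂μ = c / 2 * μ.real A := by
        rw [integral_indicator_const _ hAm, smul_eq_mul, mul_comm]
      rw [← hind]
      refine integral_mono_of_nonneg (Eventually.of_forall fun w => hφ0 _)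
        ((integrable_indicator_iff hAm).mpr (integrableOn_const hAfin.ne))
        (Eventually.of_forall fun w => ?_)
      by_cases hw : φ (r⁻¹ • (w - z)) = 0
      · simp only [hw]
        exact indicator_nonneg (fun _ _ => by positivity) w
      · rw [indicator_of_mem (hmem w hw)]
        exact hφ1 _
    have hAr : μ.real A = ratio r * μ.real (Metric.closedBall z (r * R)) := by
      simp only [ratio, ENNReal.toReal_div]
      -- If the ball is null, the quotient carries no information, but both sides vanish.
      by_cases h0 : (μ (Metric.closedBall z (r * R))).toReal = 0
      · have h1 : μ.real A ≤ μ.real (Metric.closedBall z (r * R)) :=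
          measureReal_mono inter_subset_right hfin.ne
        have h2 : μ.real (Metric.closedBall z (r * R)) = 0 := h0
        rw [h2] at h1 ⊢
        rw [mul_zero]
        exact le_antisymm h1 measureReal_nonneg
      · exact (div_mul_cancel₀ _ h0).symm
    have hratio0 : 0 ≤ ratio r := ENNReal.toReal_nonneg
    have hrm : 0 < r ^ m := by positivity
    rw [inv_mul_le_iff₀ hrm]
    calc _ ≤ c / 2 * μ.real A := hint
      _ ≤ c / 2 * (ratio r * (C * r ^ m)) := by rw [hAr]; gcongr
      _ = _ := by ring
  have hzero : Tendsto (fun r => c / 2 * (C * ratio r)) (𝓝[>] 0) (𝓝 0) := by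
    simpa using (hratio.const_mul C).const_mul (c / 2)
  exact absurd (le_of_tendsto_of_tendsto hlim hzero hbound) (not_le.mpr hpos)

namespace IntegralVarifold

variable {m : ℕ} {U : Set E} (V : IntegralVarifold m U)

theorem ae_mem_carrier : ∀ᵐ z ∂V.weight, z ∈ V.carrier :=
  (withDensity_absolutelyContinuous _ _).ae_le (ae_restrict_mem V.measurableSet_carrier)

theorem ae_mem : ∀ᵐ z ∂V.weight, z ∈ U :=
  V.ae_mem_carrier.mono fun _ hz => V.carrier_subset hz

/-- Besicovitch differentiation is applied to the restriction of the weight to closed balls inside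
U, where it is finite; for small radii the restriction changes neither measure in the quotient. -/
theorem ae_density_tendsto (hU : IsOpen U) {M : Set E} (hM : MeasurableSet M) :
    ∀ᵐ z ∂V.weight, z ∈ M →
      Tendsto (fun r => V.weight (Mᶜ ∩ Metric.closedBall z r) / V.weight (Metric.closedBall z r))
        (𝓝[>] 0) (𝓝 0) := by
  set μ := V.weight
  set P : E → Prop := fun z => z ∈ M →
      Tendsto (fun r => μ (Mᶜ ∩ Metric.closedBall z r) / μ (Metric.closedBall z r))
        (𝓝[>] 0) (𝓝 0)
  have hUae : ∀ᵐ z ∂μ, z ∈ U := V.ae_mem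
  have hnull : μ {z | z ∈ U ∧ ¬ P z} = 0 := by
    refine measure_null_of_locally_null _ fun x hx => ?_
    obtain ⟨ρ, hρ, hsub⟩ := Metric.nhds_basis_closedBall.mem_iff.mp (hU.mem_nhds hx.1)
    set K := Metric.closedBall x ρ
    have hKm : MeasurableSet K := Metric.isClosed_closedBall.measurableSet
    have hKfin : μ K < ⊤ := V.finite_on_compacts K hsub (isCompact_closedBall x ρ)
    have : IsFiniteMeasure (μ.restrict K) := ⟨by rwa [Measure.restrict_apply_univ]⟩
    have hB := Besicovitch.ae_tendsto_measure_inter_div_of_measurableSet (μ.restrict K) hM.compl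
    rw [ae_restrict_iff' hKm] at hB
    refine ⟨{z | z ∈ U ∧ ¬ P z} ∩ Metric.ball x ρ,
      inter_mem self_mem_nhdsWithin (mem_nhdsWithin_of_mem_nhds (Metric.ball_mem_nhds x hρ)), ?_⟩
    refine measure_mono_null (fun z hz => ?_) hB
    intro hgood
    refine hz.1.2 fun hzM => ?_
    have hlim := hgood (Metric.ball_subset_closedBall hz.2)
    rw [indicator_of_notMem (by simpa using hzM)] at hlim
    refine hlim.congr' ?_
    obtain ⟨s, hs, hsK⟩ := Metric.nhds_basis_closedBall.mem_iff.mp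
      (Metric.isOpen_ball.mem_nhds hz.2)
    filter_upwards [Ioc_mem_nhdsGT hs] with r hr
    have hrK : Metric.closedBall z r ⊆ K :=
      (Metric.closedBall_subset_closedBall hr.2).trans (hsK.trans Metric.ball_subset_closedBall)
    rw [Measure.restrict_apply' hKm, Measure.restrict_apply' hKm,
      inter_eq_left.mpr (inter_subset_right.trans hrK), inter_eq_left.mpr hrK]
  have hnull' : ∀ᵐ z ∂μ, ¬ (z ∈ U ∧ ¬ P z) := by
    rw [ae_iff]
    simpa using hnull
  filter_upwards [hUae, hnull'] with z h1 h2
  exact by_contra fun h => h2 ⟨h1, h⟩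

/-- The tangent planes of a varifold agree almost everywhere on a differentiable set with the
tangent planes of that set. -/
theorem ae_tangent_eq (hU : IsOpen U) {M : Set E} (hM : MeasurableSet M) {T' : E → Submodule ℝ E}
    (hfin : ∀ z ∈ M, z ∈ U → Module.finrank ℝ (T' z) = m)
    (hdiff : ∀ z ∈ M, z ∈ U → ∀ ε > 0, ∀ᶠ w in 𝓝 z, w ∈ M →
      ‖(T' z)ᗮ.starProjection (w - z)‖ ≤ ε * ‖w - z‖) :
    ∀ᵐ z ∂V.weight, z ∈ M → V.tangent z = T' z := by
  filter_upwards [V.ae_density_tendsto hU hM, V.ae_mem_carrier, V.isApproxTangent]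
    with z hdens hcar happ hzM
  have hzU := V.carrier_subset hcar
  obtain ⟨ρ, hρ, hsub⟩ := Metric.nhds_basis_closedBall.mem_iff.mp (hU.mem_nhds hzU)
  have hle : V.tangent z ≤ T' z := happ.le_of_density (by exact_mod_cast V.density_pos z hcar)
    (V.finrank_tangent z) hρ (V.finite_on_compacts _ hsub (isCompact_closedBall z ρ)) hM
    (hdens hzM) (hdiff z hzM hzU)
  exact Submodule.eq_of_le_of_finrank_eq hle (by rw [V.finrank_tangent, hfin z hzM hzU])

end IntegralVarifold

end ApproxTangent

/-! ### The distance along the tangent planes of a varifold -/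

section DistanceAlong

theorem norm_gradientAlong {E : Type*} [NormedAddCommGroup E] [InnerProductSpace ℝ E]
    [FiniteDimensional ℝ E] (T : Submodule ℝ E) (f : E → ℝ) (z : E) :
    ‖gradientAlong T f z‖ = ‖fderiv ℝ (fun v : T => f (z + v)) 0‖ :=
  LinearIsometryEquiv.norm_map _ _

variable {X Y : Type*} [NormedAddCommGroup X] [InnerProductSpace ℝ X] [FiniteDimensional ℝ X]
  [NormedAddCommGroup Y] [InnerProductSpace ℝ Y] [FiniteDimensional ℝ Y]

theorem isOpen_norm_fst_lt (r : ℝ) : IsOpen {w : WithLp 2 (X × Y) | ‖w.fst‖ < r} :=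
  isOpen_lt WithLp.prod_continuous_fst.norm continuous_const

namespace IsSmallGraph

variable {g : X → Y} {δ : ℝ} {z : WithLp 2 (X × Y)} {x : X}

theorem gradientAlong_infDist_of_ne_zero (hg : IsSmallGraph g δ) (hz : z ∈ largeSlab X Y)
    (hd : Metric.infDist z (graphOver g) ≠ 0) (T : Submodule ℝ (WithLp 2 (X × Y))) :
    DifferentiableAlong T (fun w => Metric.infDist w (graphOver g)) z ∧
      ‖gradientAlong T (fun w => Metric.infDist w (graphOver g)) z‖ ^ 2 ≤
        planeDistSq T (tangentPlane (graphOver g) (closestPoint (graphOver g) z)) := by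
  have hf := hasGradientAt_iff_hasFDerivAt.mp (hg.hasGradientAt_infDist_sq hz)
  have hdpos : 0 < Metric.infDist z (graphOver g) := lt_of_le_of_ne Metric.infDist_nonneg hd.symm
  have hdν := hg.infDist_eq_norm hz
  have hν := hg.sub_closestPoint_mem_orthogonal hz
  set d := Metric.infDist z (graphOver g) with hddef
  set ν := z - closestPoint (graphOver g) z
  -- d is recovered as √(2 · d²/2), differentiable since d > 0, with gradient ν/d.
  have h1 := (hf.const_mul 2).sqrt (by positivity)
  have hsq : ∀ w, √(2 * (Metric.infDist w (graphOver g) ^ 2 / 2)) = Metric.infDist w (graphOver g) :=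
    fun w => by rw [mul_div_cancel₀ _ two_ne_zero, Real.sqrt_sq Metric.infDist_nonneg]
  simp only [hsq] at h1
  have hadd : HasFDerivAt (fun v : T => z + (v : WithLp 2 (X × Y))) T.subtypeL 0 :=
    T.subtypeL.hasFDerivAt.const_add z
  have h1' : HasFDerivAt (fun w => Metric.infDist w (graphOver g))
      ((1 / (2 * d)) • (2 : ℝ) • (InnerProductSpace.toDual ℝ (WithLp 2 (X × Y))) ν)
      (z + ((0 : T) : WithLp 2 (X × Y))) := by
    rw [Submodule.coe_zero, add_zero]
    exact h1
  have h2 := HasFDerivAt.comp (g := fun w => Metric.infDist w (graphOver g)) (0 : T) h1' hadd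
  refine ⟨h2.differentiableAt, ?_⟩
  rw [norm_gradientAlong]
  have h3 : ‖fderiv ℝ (fun v : T => Metric.infDist (z + v) (graphOver g)) 0‖ ≤
      ‖T.starProjection ν‖ / d := by
    have h4 := h2.fderiv
    change fderiv ℝ (fun v : T => Metric.infDist (z + v) (graphOver g)) 0 = _ at h4
    rw [h4]
    refine ContinuousLinearMap.opNorm_le_bound _ (by positivity) fun v => ?_
    change ‖1 / (2 * d) * (2 * inner ℝ ν (v : WithLp 2 (X × Y)))‖ ≤ _
    have h5 : inner ℝ ν (v : WithLp 2 (X × Y)) = inner ℝ (T.starProjection ν) v := by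
      rw [Submodule.inner_starProjection_left_eq_right,
        Submodule.starProjection_eq_self_iff.mpr v.2]
    have h6 : 1 / (2 * d) * (2 * inner ℝ ν (v : WithLp 2 (X × Y))) =
        inner ℝ (T.starProjection ν) v / d := by
      rw [h5]
      field_simp
    rw [h6, norm_div, Real.norm_of_nonneg hdpos.le, div_mul_eq_mul_div]
    gcongr
    exact norm_inner_le_norm _ _
  have h7 := norm_starProjection_sq_le_planeDistSq _ T ν hν
  rw [← hdν] at h7
  calc _ ≤ (‖T.starProjection ν‖ / d) ^ 2 := by gcongr
    _ ≤ _ := by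
      rw [div_pow, div_le_iff₀ (by positivity)]
      exact h7

/-- For tangent v, the graph point over x + v.fst is within o(|v|) of z + v, so d(z + v) = o(|v|).
-/
theorem gradientAlong_infDist_tangentPlane (hg : IsSmallGraph g δ) (hx : ‖x‖ < 2) :
    DifferentiableAlong (tangentPlane (graphOver g) (graphMap g x))
        (fun w => Metric.infDist w (graphOver g)) (graphMap g x) ∧
      gradientAlong (tangentPlane (graphOver g) (graphMap g x))
        (fun w => Metric.infDist w (graphOver g)) (graphMap g x) = 0 := by
  set z := graphMap g x with hz
  set T := tangentPlane (graphOver g) z with hT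
  have hTr : T = LinearMap.range (graphDeriv g x).toLinearMap := hg.tangentPlane_eq hx
  have hzM : z ∈ graphOver g := ⟨hx, rfl⟩
  let fstT : T →L[ℝ] X := (WithLp.fstL 2 ℝ X Y) ∘L T.subtypeL
  have hDT : graphDeriv g x ∘L fstT = T.subtypeL := by
    ext1 v
    obtain ⟨a, ha⟩ : ∃ a, graphDeriv g x a = v := hTr.le v.2
    change graphDeriv g x (v : WithLp 2 (X × Y)).fst = v
    rw [← ha, graphDeriv_fst]
  have hfst : HasFDerivAt (fun v : T => x + fstT v) fstT 0 := fstT.hasFDerivAt.const_add x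
  have hG : HasFDerivAt (graphMap g) (graphDeriv g x) (x + fstT 0) := by
    rw [map_zero, add_zero]
    exact hasFDerivAt_graphMap (hg.differentiableAt hx)
  have hΨ : HasFDerivAt (fun v : T => graphMap g (x + fstT v) - (z + v)) (0 : T →L[ℝ] _) 0 := by
    have h1 := (hG.comp (0 : T) hfst).sub (T.subtypeL.hasFDerivAt.const_add z)
    rw [hDT, sub_self] at h1
    exact h1
  have hmain : HasFDerivAt (fun v : T => Metric.infDist (z + v) (graphOver g))
      (0 : T →L[ℝ] ℝ) 0 := by
    rw [hasFDerivAt_iff_isLittleO_nhds_zero] at hΨ ⊢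
    refine Asymptotics.IsBigO.trans_isLittleO ?_ hΨ
    refine Asymptotics.IsBigO.of_bound 1 ?_
    have hev : ∀ᶠ v : T in 𝓝 0, ‖x + fstT v‖ < 2 := by
      refine hfst.continuousAt.norm.eventually_lt continuousAt_const ?_
      rwa [map_zero, add_zero]
    filter_upwards [hev] with v hv
    have hmem : graphMap g (x + fstT v) ∈ graphOver g := ⟨hv, rfl⟩
    have h1 := Metric.infDist_le_dist_of_mem (x := z + v) hmem
    simp only [zero_add, map_zero, add_zero, Submodule.coe_zero, zero_apply,
      sub_zero, one_mul, Metric.infDist_zero_of_mem hzM]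
    rw [Real.norm_of_nonneg Metric.infDist_nonneg]
    refine h1.trans (le_of_eq ?_)
    rw [dist_comm, dist_eq_norm, ← hz, sub_self, sub_zero]
  refine ⟨hmain.differentiableAt, ?_⟩
  rw [← norm_eq_zero, norm_gradientAlong, hmain.fderiv]
  exact norm_zero (E := T →L[ℝ] ℝ)

theorem eventually_norm_normal_le (hg : IsSmallGraph g δ) (hz : z ∈ graphOver g) {ε : ℝ}
    (hε : 0 < ε) :
    ∀ᶠ w in 𝓝 z, w ∈ graphOver g →
      ‖(tangentPlane (graphOver g) z)ᗮ.starProjection (w - z)‖ ≤ ε * ‖w - z‖ := by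
  obtain ⟨hx, hzx⟩ := mem_graphOver_iff.mp hz
  set x := z.fst
  have h1 := (hasFDerivAt_graphMap (hg.differentiableAt hx)).isLittleO.def hε
  have h2 := (WithLp.prod_continuous_fst (X := X) (Y := Y)).continuousAt (x := z) h1
  filter_upwards [h2] with w hw hwM
  obtain ⟨_, hwx⟩ := mem_graphOver_iff.mp hwM
  have hw' : ‖graphMap g w.fst - graphMap g x - graphDeriv g x (w.fst - x)‖ ≤ ε * ‖w.fst - x‖ := hw
  rw [← hwx, ← hzx] at hw'
  have h3 : (tangentPlane (graphOver g) z)ᗮ.starProjection (graphDeriv g x (w.fst - x)) = 0 := by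
    refine (Submodule.starProjection_apply_eq_zero_iff _).mpr ?_
    rw [Submodule.orthogonal_orthogonal, hzx, hg.tangentPlane_eq hx]
    exact ⟨_, rfl⟩
  have h4 : (tangentPlane (graphOver g) z)ᗮ.starProjection (w - z) =
      (tangentPlane (graphOver g) z)ᗮ.starProjection (w - z - graphDeriv g x (w.fst - x)) := by
    rw [map_sub _ (w - z), h3, sub_zero]
  rw [h4]
  refine (Submodule.norm_starProjection_apply_le _ _).trans (hw'.trans ?_)
  gcongr
  exact WithLp.prod_norm_fst_le (w - z)

variable [MeasurableSpace (WithLp 2 (X × Y))] [BorelSpace (WithLp 2 (X × Y))]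

theorem measurableSet_graphOver (hg : IsSmallGraph g δ) : MeasurableSet (graphOver g) := by
  have hopen : IsOpen {w : WithLp 2 (X × Y) | ‖w.fst‖ < 2} :=
    isOpen_norm_fst_lt 2
  have hcont : ContinuousOn (fun w : WithLp 2 (X × Y) => w.snd - g w.fst)
      {w : WithLp 2 (X × Y) | ‖w.fst‖ < 2} := fun w hw =>
    (WithLp.prod_continuous_snd.continuousAt.sub (ContinuousAt.comp (g := g)
      (hg.differentiableAt hw).continuousAt
      WithLp.prod_continuous_fst.continuousAt)).continuousWithinAt
  have h1 := hcont.isOpen_inter_preimage hopen (isOpen_compl_singleton (x := (0 : Y)))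
  have h2 : graphOver g = {w : WithLp 2 (X × Y) | ‖w.fst‖ < 2} \
      ({w : WithLp 2 (X × Y) | ‖w.fst‖ < 2} ∩ (fun w => w.snd - g w.fst) ⁻¹' {0}ᶜ) := by
    ext w
    simp only [graphOver, mem_ofPred_eq, Set.mem_sdiff, mem_inter_iff, mem_preimage, mem_compl_iff,
      mem_singleton_iff, sub_eq_zero]
    tauto
  rw [h2]
  exact hopen.measurableSet.diff h1.measurableSet

/-- The distance from a flat graph along the tangent planes of a varifold. -/
theorem ae_gradientAlong_infDist (hg : IsSmallGraph g δ) {m : ℕ} (hm : Module.finrank ℝ X = m)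
    {U : Set (WithLp 2 (X × Y))} (hU : IsOpen U) (V : IntegralVarifold m U)
    (hV : ∀ᵐ z ∂V.weight, z ∈ largeSlab X Y) :
    ∀ᵐ z ∂V.weight,
      DifferentiableAlong (V.tangent z) (fun w => Metric.infDist w (graphOver g)) z ∧
      ‖gradientAlong (V.tangent z) (fun w => Metric.infDist w (graphOver g)) z‖ ^ 2 ≤
        planeDistSq (V.tangent z) (tangentPlane (graphOver g) (closestPoint (graphOver g) z)) := by
  have htan := V.ae_tangent_eq hU hg.measurableSet_graphOver
    (T' := tangentPlane (graphOver g))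
    (fun z hz _ => by
      obtain ⟨h1, h2⟩ := mem_graphOver_iff.mp hz
      rw [h2, hg.tangentPlane_eq h1, finrank_range_graphDeriv, hm])
    (fun z hz _ ε hε => hg.eventually_norm_normal_le hz hε)
  filter_upwards [hV, htan] with z hz htz
  by_cases hd : Metric.infDist z (graphOver g) = 0
  · have hzM : z ∈ graphOver g := by
      have h1 := (hg.isClosestPoint_closestPoint hz)
      have h2 := h1.2
      rw [hd, dist_eq_zero] at h2
      rw [h2]
      exact h1.1
    obtain ⟨h1, h2⟩ := mem_graphOver_iff.mp hzM
    have h3 := hg.gradientAlong_infDist_tangentPlane h1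
    rw [← h2] at h3
    rw [htz hzM]
    refine ⟨h3.1, ?_⟩
    rw [h3.2, norm_zero, zero_pow two_ne_zero]
    exact planeDistSq_nonneg _ _
  · exact hg.gradientAlong_infDist_of_ne_zero hz hd _

end IsSmallGraph

end DistanceAlong

/-! ### The tilt-excess inequality -/

section TiltExcess

/-- Neither f nor h is assumed measurable, and the integral of h may be infinite. Moving the
negative part of G to the left leaves only sums in which one term is measurable, and the finite
integrals of the two parts of G cancel. -/
theorem lintegral_le_of_le_add_of_integral_eq_zero {α : Type*} [MeasurableSpace α] {μ : Measure α}
    {f G h : α → ℝ} (hG : Integrable G μ) (hG0 : ∫ z, G z ∂μ = 0) (hf : ∀ᵐ z ∂μ, 0 ≤ f z)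
    (hh : ∀ᵐ z ∂μ, 0 ≤ h z) (hle : ∀ᵐ z ∂μ, f z ≤ G z + h z) :
    ∫⁻ z, ENNReal.ofReal (f z) ∂μ ≤ ∫⁻ z, ENNReal.ofReal (h z) ∂μ := by
  have hpos : AEMeasurable (fun z => ENNReal.ofReal (G z)) μ := hG.aemeasurable.ennreal_ofReal
  have hneg : AEMeasurable (fun z => ENNReal.ofReal (-G z)) μ :=
    hG.aemeasurable.neg.ennreal_ofReal
  have hfin : ∫⁻ z, ENNReal.ofReal (G z) ∂μ ≠ ⊤ := hG.lintegral_lt_top.ne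
  have hfin' : ∫⁻ z, ENNReal.ofReal (-G z) ∂μ ≠ ⊤ := hG.neg.lintegral_lt_top.ne
  have heq : ∫⁻ z, ENNReal.ofReal (G z) ∂μ = ∫⁻ z, ENNReal.ofReal (-G z) ∂μ := by
    rw [integral_eq_lintegral_pos_part_sub_lintegral_neg_part hG, sub_eq_zero] at hG0
    exact (ENNReal.toReal_eq_toReal_iff' hfin hfin').mp hG0
  have hpt : ∀ᵐ z ∂μ, ENNReal.ofReal (f z) + ENNReal.ofReal (-G z) ≤
      ENNReal.ofReal (G z) + ENNReal.ofReal (h z) := by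
    filter_upwards [hf, hh, hle] with z h1 h2 h3
    rcases le_total 0 (G z) with h4 | h4
    · rw [ENNReal.ofReal_of_nonpos (neg_nonpos.mpr h4), add_zero, ← ENNReal.ofReal_add h4 h2]
      exact ENNReal.ofReal_le_ofReal h3
    · rw [ENNReal.ofReal_of_nonpos h4, zero_add, ← ENNReal.ofReal_add h1 (neg_nonneg.mpr h4)]
      exact ENNReal.ofReal_le_ofReal (by linarith)
  have hint := lintegral_mono_ae hpt
  rw [lintegral_add_right' _ hneg, lintegral_add_left' hpos, heq, add_comm] at hint
  exact (ENNReal.add_le_add_iff_left hfin').mp hint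

/-! ### Divergence along planes and cutoff functions -/

section General

variable {E : Type*} [NormedAddCommGroup E] [InnerProductSpace ℝ E] [FiniteDimensional ℝ E]

theorem divAlong_eq_sum (T : Submodule ℝ E) (Z : E → E) (z : E) :
    divAlong T Z z = ∑ i, inner ℝ (T.starProjection (stdOrthonormalBasis ℝ E i))
      (fderiv ℝ Z z (stdOrthonormalBasis ℝ E i)) := by
  refine (clmTrace_eq_sum (stdOrthonormalBasis ℝ E) (T.starProjection * fderiv ℝ Z z)).trans ?_
  refine Finset.sum_congr rfl fun i _ => ?_
  rw [Submodule.inner_starProjection_left_eq_right]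
  rfl

theorem divAlong_congr {T : Submodule ℝ E} {Z Z' : E → E} {z : E} (h : Z =ᶠ[𝓝 z] Z') :
    divAlong T Z z = divAlong T Z' z := by
  rw [divAlong, divAlong, h.fderiv_eq]

/-- A smooth cutoff between a closed set and a bounded open neighbourhood. -/
theorem exists_contDiff_cutoff {K O : Set E} (hK : IsClosed K) (hO : IsOpen O) (hKO : K ⊆ O)
    (hbd : Bornology.IsBounded O) :
    ∃ χ : E → ℝ, ContDiff ℝ ∞ χ ∧ HasCompactSupport χ ∧ tsupport χ ⊆ O ∧
      ∀ z ∈ K, χ =ᶠ[𝓝 z] 1 := by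
  obtain ⟨χ, h0, h1, -⟩ := exists_contMDiffMap_zero_one_nhds_of_isClosed (n := ⊤)
    (modelWithCornersSelf ℝ E) hO.isClosed_compl hK
    (disjoint_left.mpr fun z hz hzK => hz (hKO hzK))
  have hts : tsupport χ ⊆ O := by
    intro z hz
    by_contra hzO
    exact notMem_tsupport_iff_eventuallyEq.mpr (h0.filter_mono (nhds_le_nhdsSet hzO)) hz
  refine ⟨χ, χ.contMDiff.contDiff, ?_, hts, fun z hz => h1.filter_mono (nhds_le_nhdsSet hz)⟩
  exact Metric.isCompact_of_isClosed_isBounded (isClosed_tsupport _) (hbd.subset hts)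

variable [MeasurableSpace E] [BorelSpace E]

/-- Stationarity is stated with a Bochner integral, whose vanishing is informative only for an
integrable divergence. -/
theorem IntegralVarifold.integrable_divAlong {m : ℕ} {U : Set E} (V : IntegralVarifold m U)
    {Z : E → E} (hZ : ContDiff ℝ ∞ Z) (hc : HasCompactSupport Z) (hs : tsupport Z ⊆ U) :
    Integrable (fun z => divAlong (V.tangent z) Z z) V.weight := by
  have hcont : Continuous (fderiv ℝ Z) := hZ.continuous_fderiv (by simp)
  obtain ⟨C, hC⟩ := hcont.bounded_above_of_compact_support (hc.fderiv (𝕜 := ℝ))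
  simp only [divAlong_eq_sum]
  refine integrable_finsetSum _ fun i _ => ?_
  set e := stdOrthonormalBasis ℝ E i
  have he : ‖e‖ = 1 := (stdOrthonormalBasis ℝ E).norm_eq_one i
  refine integrable_of_support_subset (s := tsupport Z) (C := C)
    (V.finite_on_compacts _ hs hc) ?_ (fun z => ?_) fun z hz => ?_
  · exact (V.measurable_tangent e).inner (hcont.clm_apply continuous_const).measurable
  · refine (norm_inner_le_norm _ _).trans ?_
    have h1 : ‖(V.tangent z).starProjection e‖ ≤ 1 :=
      (Submodule.norm_starProjection_apply_le _ _).trans he.le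
    have h2 : ‖fderiv ℝ Z z e‖ ≤ C := by
      refine ((fderiv ℝ Z z).le_opNorm e).trans ?_
      rw [he, mul_one]
      exact hC z
    nlinarith [norm_nonneg ((V.tangent z).starProjection e), norm_nonneg (fderiv ℝ Z z e)]
  · rw [fderiv_of_notMem_tsupport ℝ hz]
    simp

end General

variable {X Y : Type*} [NormedAddCommGroup X] [InnerProductSpace ℝ X] [FiniteDimensional ℝ X]
  [NormedAddCommGroup Y] [InnerProductSpace ℝ Y] [FiniteDimensional ℝ Y]

namespace IsSmallGraph

variable {g : X → Y} {δ : ℝ} {z : WithLp 2 (X × Y)}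

theorem divAlong_smul_sub_closestPoint (hg : IsSmallGraph g δ) (hz : z ∈ largeSlab X Y)
    {ζ : X → ℝ} (hζ : ContDiff ℝ ∞ ζ) (T : Submodule ℝ (WithLp 2 (X × Y))) :
    divAlong T (fun w => ζ w.fst ^ 2 • (w - closestPoint (graphOver g) w)) z =
      ζ z.fst ^ 2 * laplacianAlong T (fun w => Metric.infDist w (graphOver g) ^ 2 / 2) z
        + 2 * ζ z.fst *
          fderiv ℝ ζ z.fst (T.starProjection (z - closestPoint (graphOver g) z)).fst := by
  have hζz : HasFDerivAt ζ (fderiv ℝ ζ z.fst) z.fst :=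
    (hζ.differentiable (by simp) z.fst).hasFDerivAt
  have h1 : HasFDerivAt (fun w : WithLp 2 (X × Y) => ζ w.fst)
      (fderiv ℝ ζ z.fst ∘L WithLp.fstL 2 ℝ X Y) z := hζz.comp z (WithLp.prod_hasFDerivAt_fst z)
  have h2 := (h1.pow 2).smul ((hasFDerivAt_id z).sub (hg.hasFDerivAt_closestPoint hz))
  set L := fderiv ℝ (closestPoint (graphOver g)) z
  set ν := z - closestPoint (graphOver g) z
  set ℓ : WithLp 2 (X × Y) →L[ℝ] ℝ := (2 * ζ z.fst) • (fderiv ℝ ζ z.fst ∘L WithLp.fstL 2 ℝ X Y)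
  have h3 : HasFDerivAt (fun w => ζ w.fst ^ 2 • (w - closestPoint (graphOver g) w))
      (ζ z.fst ^ 2 • (1 - L) + ℓ.smulRight ν) z := by
    refine h2.congr_fderiv ?_
    ext1 h
    change ζ z.fst ^ 2 • (h - L h) + (_ : ℝ) • ν = ζ z.fst ^ 2 • (h - L h) + ℓ h • ν
    congr 2
    simp [ℓ]
  have h4 : divAlong T (fun w => ζ w.fst ^ 2 • (w - closestPoint (graphOver g) w)) z =
      clmTrace (T.starProjection * (ζ z.fst ^ 2 • (1 - L) + ℓ.smulRight ν)) := by
    rw [divAlong, h3.fderiv]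
    rfl
  have h5 : T.starProjection * ℓ.smulRight ν = ℓ.smulRight (T.starProjection ν) := by
    ext1 h
    exact map_smul T.starProjection (ℓ h) ν
  rw [h4, mul_add, clmTrace_add, h5, clmTrace_smulRight, mul_smul_comm, clmTrace_smul,
    hg.laplacianAlong_infDist_sq hz]
  rfl

/-- The pointwise form of the tilt-excess inequality. -/
theorem sq_mul_planeDistSq_le (hg : IsSmallGraph g δ) (hδ : Module.finrank ℝ X * δ ≤ 1 / 2)
    (hz : z ∈ largeSlab X Y) (hz1 : ‖z.fst‖ < 1) {T : Submodule ℝ (WithLp 2 (X × Y))}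
    (hT : Module.finrank ℝ T = Module.finrank ℝ X) {ζ : X → ℝ} (hζ : ContDiff ℝ ∞ ζ)
    (hζ0 : ∀ x, 0 ≤ ζ x) (hζ1 : ∀ x, ζ x ≤ 1) {K : ℝ} (hK : ∀ x, ‖fderiv ℝ ζ x‖ ≤ K) :
    ζ z.fst ^ 2 * planeDistSq T (tangentPlane (graphOver g) (closestPoint (graphOver g) z)) ≤
      8 * divAlong T (fun w => ζ w.fst ^ 2 • (w - closestPoint (graphOver g) w)) z
        + (64 * K ^ 2 + 16) * (Metric.infDist z (graphOver g) ^ 2 + Metric.infDist z (graphOver g) *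
          ‖meanCurvature (graphOver g) (closestPoint (graphOver g) z)‖) := by
  have hlap := hg.laplacianAlong_infDist_sq_ge hδ hz hz1 hT
  have hν := norm_starProjection_sq_le_planeDistSq _ T _ (hg.sub_closestPoint_mem_orthogonal hz)
  rw [hg.divAlong_smul_sub_closestPoint hz hζ]
  have hII : secondFundamentalFormNorm (graphOver g) (closestPoint (graphOver g) z) ≤ 1 := by
    have h1 := hg.secondFundamentalFormNorm_le (hg.norm_fst_closestPoint_lt_of_norm_fst_lt hz hz1)
    rw [← hg.closestPoint_eq_graphMap hz] at h1
    linarith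
  rw [← hg.infDist_eq_norm hz] at hν
  have hτ := planeDistSq_nonneg T (tangentPlane (graphOver g) (closestPoint (graphOver g) z))
  have hd : 0 ≤ Metric.infDist z (graphOver g) := Metric.infDist_nonneg
  have hK0 : 0 ≤ K := (norm_nonneg _).trans (hK 0)
  set τ := planeDistSq T (tangentPlane (graphOver g) (closestPoint (graphOver g) z))
  set H := ‖meanCurvature (graphOver g) (closestPoint (graphOver g) z)‖
  have hH : 0 ≤ H := norm_nonneg _
  set d := Metric.infDist z (graphOver g)
  set Λ := laplacianAlong T (fun w => Metric.infDist w (graphOver g) ^ 2 / 2) z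
  set P := T.starProjection (z - closestPoint (graphOver g) z)
  set κ := secondFundamentalFormNorm (graphOver g) (closestPoint (graphOver g) z)
  set s := ζ z.fst
  have hs0 : 0 ≤ s := hζ0 _
  have hs1 : s ^ 2 ≤ 1 := pow_le_one₀ hs0 (hζ1 _)
  set D := fderiv ℝ ζ z.fst P.fst
  -- The vector z - p(z) is normal to M, so its projection to T is controlled by the tilt.
  have hD : D ^ 2 ≤ K ^ 2 * (τ * d ^ 2) := by
    have h1 : ‖D‖ ≤ K * ‖P‖ := ((fderiv ℝ ζ z.fst).le_opNorm P.fst).trans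
      (mul_le_mul (hK _) (WithLp.prod_norm_fst_le P) (norm_nonneg _) hK0)
    calc D ^ 2 = ‖D‖ ^ 2 := by rw [Real.norm_eq_abs, sq_abs]
      _ ≤ (K * ‖P‖) ^ 2 := by gcongr
      _ = K ^ 2 * ‖P‖ ^ 2 := by ring
      _ ≤ _ := by gcongr
  -- Weighted arithmetic-geometric mean. Doubled, the tilt term is s²τ/8, half of the s²τ/4 from the
  -- Laplacian; multiplying what remains by 8 gives the constants 64K² and 16.
  have hcross : -(s * D) ≤ s ^ 2 * τ / 16 + 4 * (K ^ 2 * d ^ 2) := by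
    have h1 : (s * D) ^ 2 ≤ (s ^ 2 * τ / 16 + 4 * (K ^ 2 * d ^ 2)) ^ 2 := by
      have h2 : (s * D) ^ 2 ≤ s ^ 2 * (K ^ 2 * (τ * d ^ 2)) := by
        rw [mul_pow]
        gcongr
      nlinarith [sq_nonneg (s ^ 2 * τ / 16 - 4 * (K ^ 2 * d ^ 2))]
    have h3 := abs_le_of_sq_le_sq' h1 (by positivity)
    linarith [h3.1]
  have hlap' : s ^ 2 * (τ / 4 - H * d - 2 * κ * d ^ 2) ≤ s ^ 2 * Λ := by gcongr
  have h1 : s ^ 2 * (H * d) ≤ 1 * (H * d) := by gcongr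
  have h2 : s ^ 2 * (κ * d ^ 2) ≤ 1 * (1 * d ^ 2) := by
    have : 0 ≤ κ := Real.sqrt_nonneg _
    gcongr
  have h3 : 0 ≤ K ^ 2 * (d * H) := by positivity
  have h4 : 0 ≤ H * d := by positivity
  nlinarith

variable [MeasurableSpace (WithLp 2 (X × Y))] [BorelSpace (WithLp 2 (X × Y))]

theorem lintegral_planeDistSq_le (hg : IsSmallGraph g δ) (hδ : Module.finrank ℝ X * δ ≤ 1 / 2)
    {m : ℕ} (hm : Module.finrank ℝ X = m)
    (V : IntegralVarifold m {w : WithLp 2 (X × Y) | ‖w.fst‖ < 1}) (hV : V.IsStationary)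
    (hsupp : V.supp ⊆ {w | ‖w.fst‖ < 1 ∧ ‖w.snd‖ < 1}) {ζ : X → ℝ} (hζ : ContDiff ℝ ∞ ζ)
    (hζ0 : ∀ x, 0 ≤ ζ x) (hζ1 : ∀ x, ζ x ≤ 1) (hζin : ∀ x, ‖x‖ < 1 / 2 → ζ x = 1)
    (hζout : ∀ x, 3 / 4 ≤ ‖x‖ → ζ x = 0) {K : ℝ} (hK : ∀ x, ‖fderiv ℝ ζ x‖ ≤ K) :
    ∫⁻ z in {w | ‖w.fst‖ < 1 / 2}, ENNReal.ofReal (planeDistSq (V.tangent z)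
        (tangentPlane (graphOver g) (closestPoint (graphOver g) z))) ∂V.weight ≤
      ENNReal.ofReal (64 * K ^ 2 + 16) * ∫⁻ z in {w | ‖w.fst‖ < 1}, ENNReal.ofReal
        (Metric.infDist z (graphOver g) ^ 2 + Metric.infDist z (graphOver g) *
          ‖meanCurvature (graphOver g) (closestPoint (graphOver g) z)‖) ∂V.weight := by
  set μ := V.weight
  set O : Set (WithLp 2 (X × Y)) := {w | ‖w.fst‖ < 1 ∧ ‖w.snd‖ < 1}
  have hOopen : IsOpen O := (isOpen_norm_fst_lt 1).inter
    (isOpen_lt WithLp.prod_continuous_snd.norm continuous_const)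
  have hObd : Bornology.IsBounded O := by
    refine isBounded_iff_forall_norm_le.mpr ⟨2, fun w hw => ?_⟩
    linarith [WithLp.prod_norm_le_add w, hw.1, hw.2]
  have hOslab : O ⊆ largeSlab X Y := fun w hw => ⟨by linarith [hw.1], by linarith [hw.2]⟩
  -- The field Z₀ is smooth only near the slab and need not have compact support, so it is
  -- multiplied by a cutoff χ equal to 1 near S.
  set S : Set (WithLp 2 (X × Y)) := μ.support ∩ {w | ‖w.fst‖ ≤ 3 / 4}
  have hSclosed : IsClosed S := Measure.isClosed_support.inter
    (isClosed_le WithLp.prod_continuous_fst.norm continuous_const)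
  have hSO : S ⊆ O := fun w hw => hsupp ⟨by
    have h : ‖w.fst‖ ≤ 3 / 4 := hw.2
    exact (by linarith : ‖w.fst‖ < 1), hw.1⟩
  obtain ⟨χ, hχ, hχc, hχO, hχ1⟩ := exists_contDiff_cutoff hSclosed hOopen hSO hObd
  let Z₀ : WithLp 2 (X × Y) → WithLp 2 (X × Y) :=
    fun w => ζ w.fst ^ 2 • (w - closestPoint (graphOver g) w)
  let Z : WithLp 2 (X × Y) → WithLp 2 (X × Y) := fun w => χ w • Z₀ w
  have hZ₀ : ∀ w ∈ O, ContDiffAt ℝ ∞ Z₀ w := fun w hw =>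
    ((ContDiffAt.comp w hζ.contDiffAt WithLp.prod_contDiff_fst.contDiffAt).pow 2).smul
      (contDiffAt_id.sub (hg.contDiffAt_closestPoint (hOslab hw)))
  have hZts : tsupport Z ⊆ tsupport χ := closure_mono (Function.support_smul_subset_left χ Z₀)
  have hZ : ContDiff ℝ ∞ Z := by
    refine contDiff_iff_contDiffAt.mpr fun w => ?_
    by_cases hw : w ∈ tsupport Z
    · exact hχ.contDiffAt.smul (hZ₀ w (hχO (hZts hw)))
    · exact contDiffAt_const.congr_of_eventuallyEq (notMem_tsupport_iff_eventuallyEq.mp hw)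
  have hZc : HasCompactSupport Z := hχc.smul_right
  have hZU : tsupport Z ⊆ {w : WithLp 2 (X × Y) | ‖w.fst‖ < 1} := fun w hw => (hχO (hZts hw)).1
  have hstat := hV Z hZ hZc hZU
  have hint := V.integrable_divAlong hZ hZc hZU
  have hsuppae : ∀ᵐ z ∂μ, z ∈ μ.support := Measure.support_mem_ae
  -- On the support the cutoff is invisible: either χ = 1 near z, or |z.fst| > 3/4 and both fields
  -- vanish near z because ζ does.
  have hdiv : ∀ z, z ∈ μ.support → divAlong (V.tangent z) Z z = divAlong (V.tangent z) Z₀ z := by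
    intro z hz
    refine divAlong_congr ?_
    rcases le_or_gt ‖z.fst‖ (3 / 4) with h | h
    · filter_upwards [hχ1 z ⟨hz, h⟩] with w hw
      simp [Z, hw]
    · have hopen : IsOpen {w : WithLp 2 (X × Y) | 3 / 4 < ‖w.fst‖} :=
        isOpen_lt continuous_const WithLp.prod_continuous_fst.norm
      filter_upwards [hopen.mem_nhds h] with w hw
      have hw' : (3 : ℝ) / 4 < ‖w.fst‖ := hw
      simp [Z, Z₀, hζout _ hw'.le]
  set F : WithLp 2 (X × Y) → ℝ := fun z => Metric.infDist z (graphOver g) ^ 2 +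
    Metric.infDist z (graphOver g) * ‖meanCurvature (graphOver g) (closestPoint (graphOver g) z)‖
  set τ : WithLp 2 (X × Y) → ℝ := fun z => planeDistSq (V.tangent z)
    (tangentPlane (graphOver g) (closestPoint (graphOver g) z))
  have hF0 : ∀ z, 0 ≤ F z := fun z => add_nonneg (sq_nonneg _)
    (mul_nonneg Metric.infDist_nonneg (norm_nonneg _))
  have hmain : ∫⁻ z, ENNReal.ofReal (ζ z.fst ^ 2 * τ z) ∂μ ≤
      ∫⁻ z, ENNReal.ofReal ((64 * K ^ 2 + 16) * F z) ∂μ := by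
    refine lintegral_le_of_le_add_of_integral_eq_zero
      (G := fun z => 8 * divAlong (V.tangent z) Z z) (hint.const_mul 8) ?_
      (Eventually.of_forall fun z => mul_nonneg (sq_nonneg _) (planeDistSq_nonneg _ _))
      (Eventually.of_forall fun z => mul_nonneg (by positivity) (hF0 z)) ?_
    · rw [integral_const_mul, hstat, mul_zero]
    · filter_upwards [hsuppae, V.ae_mem] with z hz hzU
      have hzO : z ∈ O := hsupp ⟨hzU, hz⟩
      rw [hdiv z hz]
      exact hg.sq_mul_planeDistSq_le hδ (hOslab hzO) hzO.1
        (by rw [V.finrank_tangent, hm]) hζ hζ0 hζ1 hK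
  have hU : μ.restrict {w : WithLp 2 (X × Y) | ‖w.fst‖ < 1} = μ :=
    Measure.restrict_eq_self_of_ae_mem V.ae_mem
  rw [hU, ← lintegral_const_mul' _ _ ENNReal.ofReal_ne_top]
  have hmeas : MeasurableSet {w : WithLp 2 (X × Y) | ‖w.fst‖ < 1 / 2} :=
    (isOpen_norm_fst_lt (1 / 2)).measurableSet
  calc ∫⁻ z in {w : WithLp 2 (X × Y) | ‖w.fst‖ < 1 / 2}, ENNReal.ofReal (τ z) ∂μ
      = ∫⁻ z in {w : WithLp 2 (X × Y) | ‖w.fst‖ < 1 / 2},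
          ENNReal.ofReal (ζ z.fst ^ 2 * τ z) ∂μ := by
        refine setLIntegral_congr_fun hmeas fun z hz => ?_
        simp only [hζin z.fst hz, one_pow, one_mul]
    _ ≤ ∫⁻ z, ENNReal.ofReal (ζ z.fst ^ 2 * τ z) ∂μ := setLIntegral_le_lintegral _ _
    _ ≤ ∫⁻ z, ENNReal.ofReal ((64 * K ^ 2 + 16) * F z) ∂μ := hmain
    _ = _ := by
      refine lintegral_congr fun z => ?_
      rw [ENNReal.ofReal_mul (by positivity)]

end IsSmallGraph

/-- A smooth cutoff between the balls of radius `1 / 2` and `3 / 4`. -/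
theorem exists_radial_cutoff (X : Type*) [NormedAddCommGroup X] [InnerProductSpace ℝ X]
    [FiniteDimensional ℝ X] :
    ∃ ζ : X → ℝ, ContDiff ℝ ∞ ζ ∧ (∀ x, 0 ≤ ζ x) ∧ (∀ x, ζ x ≤ 1) ∧
      (∀ x, ‖x‖ < 1 / 2 → ζ x = 1) ∧ (∀ x, 3 / 4 ≤ ‖x‖ → ζ x = 0) ∧
      ∃ K, ∀ x, ‖fderiv ℝ ζ x‖ ≤ K := by
  let ζ : ContDiffBump (0 : X) := ⟨1 / 2, 3 / 4, by norm_num, by norm_num⟩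
  have hζ : ContDiff ℝ ∞ ζ := ζ.contDiff
  refine ⟨ζ, hζ, fun x => ζ.nonneg, fun x => ζ.le_one, fun x hx => ?_, fun x hx => ?_, ?_⟩
  · exact ζ.one_of_mem_closedBall (mem_closedBall_zero_iff.mpr hx.le)
  · exact ζ.zero_of_le_dist (by rwa [dist_zero_right])
  · exact (hζ.continuous_fderiv (by simp)).bounded_above_of_compact_support
      (ζ.hasCompactSupport.fderiv (𝕜 := ℝ))

end TiltExcess

/-- A smooth flat submanifold is a small graph. -/
theorem IsFlatIn.exists_isSmallGraph {m n : ℕ} {δ : ℝ} (hδ : δ ≤ 1 / 20) {M : Set (Ambient m n)}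
    (hM : M ⊆ openCylinder m n 2) (hsm : IsSmoothSubmanifold M) (hflat : IsFlatIn δ M 2) :
    ∃ g : EuclideanSpace ℝ (Fin m) → EuclideanSpace ℝ (Fin n),
      IsSmallGraph g δ ∧ M = graphOver g := by
  obtain ⟨g, hg2, hgraph, hbd⟩ := hflat
  rw [inter_eq_left.mpr hM] at hgraph
  have hbd' : ∀ x : EuclideanSpace ℝ (Fin m), ‖x‖ < 2 →
      2⁻¹ * ‖g x‖ + ‖fderiv ℝ g x‖ + 2 * ‖fderiv ℝ (fderiv ℝ g) x‖ ≤ δ :=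
    fun x hx => hbd x (by simpa using hx)
  refine ⟨g, ⟨?_, ?_, hδ, fun x hx => ?_, fun x hx => ?_, fun x hx => ?_⟩, hgraph⟩
  · exact contDiffOn_of_isSmoothSubmanifold_graph hgraph hsm (hg2.differentiableOn (by simp))
  · refine le_trans ?_ (hbd' 0 (by simp))
    positivity
  all_goals
    have h := hbd' x hx
    linarith [norm_nonneg (g x), norm_nonneg (fderiv ℝ g x),
      norm_nonneg (fderiv ℝ (fderiv ℝ g) x)]

end

theorem proposition2p6 (m n : ℕ) (hm : 1 ≤ m) (hn : 1 ≤ n) :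
    ∃ C > (0 : ℝ), ∃ δ₀ > (0 : ℝ), ∀ δ ≤ δ₀, ∀ M : Set (Ambient m n),
      M ⊆ openCylinder m n 2 → IsSmoothSubmanifold M → IsFlatIn δ M 2 →
      -- the closest-point projection onto `M` is well defined on the slab
      (∀ z ∈ unitSlab m n, ∃! q, IsClosestPoint M z q) ∧
      ∀ V : IntegralVarifold m (openCylinder m n 1), V.IsStationary → V.supp ⊆ unitSlab m n →
        -- `|D_V d_M|² ≤ |T_z V - T_{p(z)} M|²`
        (∀ᵐ z ∂V.weight,
          DifferentiableAlong (V.tangent z) (fun w => Metric.infDist w M) z ∧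
          ‖gradientAlong (V.tangent z) (fun w => Metric.infDist w M) z‖ ^ 2 ≤
            planeDistSq (V.tangent z) (tangentPlane M (closestPoint M z))) ∧
        -- `Δ_V (d_M² / 2) ≥ |T_z V - T_{p(z)} M|² / 4 - |H| d_M - 2 |II| d_M²`
        (∀ᵐ z ∂V.weight,
          ContDiffAt ℝ ∞ (fun w => Metric.infDist w M ^ 2 / 2) z ∧
          planeDistSq (V.tangent z) (tangentPlane M (closestPoint M z)) / 4
              - ‖meanCurvature M (closestPoint M z)‖ * Metric.infDist z M
              - 2 * secondFundamentalFormNorm M (closestPoint M z) * Metric.infDist z M ^ 2 ≤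
            laplacianAlong (V.tangent z) (fun w => Metric.infDist w M ^ 2 / 2) z) ∧
        -- the tilt-excess inequality
        ∫⁻ z in openCylinder m n (1 / 2), ENNReal.ofReal
            (planeDistSq (V.tangent z) (tangentPlane M (closestPoint M z))) ∂V.weight ≤
          ENNReal.ofReal C * ∫⁻ z in openCylinder m n 1, ENNReal.ofReal
            (Metric.infDist z M ^ 2 +
              Metric.infDist z M * ‖meanCurvature M (closestPoint M z)‖) ∂V.weight := by

  have hm0 : (1 : ℝ) ≤ m := by exact_mod_cast hm
  have hfin : Module.finrank ℝ (EuclideanSpace ℝ (Fin m)) = m := finrank_euclideanSpace_fin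
  obtain ⟨ζ, hζ, hζ0, hζ1, hζin, hζout, K, hK⟩ := exists_radial_cutoff (EuclideanSpace ℝ (Fin m))
  -- K bounds |Dζ| for a cutoff fixed by m alone. The choice of δ₀ gives both δ ≤ 1/20, for the
  -- projection, and mδ ≤ 1/2, for |II| ≤ 1/4.
  refine ⟨64 * K ^ 2 + 16, by positivity, 1 / (20 * m), by positivity, ?_⟩
  intro δ hδ M hMC hMs hMf
  have hδ20 : δ ≤ 1 / 20 := by
    refine hδ.trans (one_div_le_one_div_of_le (by norm_num) ?_)
    linarith
  obtain ⟨g, hg, rfl⟩ := hMf.exists_isSmallGraph hδ20 hMC hMs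
  have hδm : Module.finrank ℝ (EuclideanSpace ℝ (Fin m)) * δ ≤ 1 / 2 := by
    rw [hfin]
    calc (m : ℝ) * δ ≤ m * (1 / (20 * m)) := by gcongr
      _ = 1 / 20 := by field_simp
      _ ≤ 1 / 2 := by norm_num
  have hslab : ∀ z ∈ unitSlab m n,
      z ∈ largeSlab (EuclideanSpace ℝ (Fin m)) (EuclideanSpace ℝ (Fin n)) :=
    fun z hz => ⟨by linarith [hz.1], by linarith [hz.2]⟩
  refine ⟨fun z hz => hg.existsUnique_isClosestPoint (hslab z hz), fun V hV hsupp => ?_⟩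
  have hae : ∀ᵐ z ∂V.weight, z ∈ unitSlab m n := by
    have hs : ∀ᵐ z ∂V.weight, z ∈ V.weight.support := Measure.support_mem_ae
    filter_upwards [hs, V.ae_mem] with z h1 h2
    exact hsupp ⟨h2, h1⟩
  refine ⟨?_, ?_, ?_⟩
  · exact hg.ae_gradientAlong_infDist hfin (isOpen_norm_fst_lt 1) V (hae.mono hslab)
  · filter_upwards [hae] with z hz
    exact ⟨hg.contDiffAt_infDist_sq (hslab z hz),
      hg.laplacianAlong_infDist_sq_ge hδm (hslab z hz) hz.1
        (by rw [V.finrank_tangent, hfin])⟩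
  · exact hg.lintegral_planeDistSq_le hδm hfin V hV hsupp hζ hζ0 hζ1 hζin hζout hK
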